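/- \textbf{Setting.} A \emph{phase function} is a $C^1$ function $\varphi:\mathbb R\to\mathbb R$ with $\varphi(t+1)=\varphi(t)+2\pi N$ for all $t$, for some integer $N$. For a phase function $\varphi$ put $L_\varphi=\frac{\varphi(1)-\varphi(0)}{2\pi}$ and $\bar\varphi=\frac{\varphi-\varphi(0)}{2\pi L_\varphi}$. For a function $g$ let $\mathcal F(g)(k)=\int_0^1 g(t)e^{-2\pi ikt}\,dt$ $(k\in\mathbb Z)$, $\|\mathcal F(g)\|_1=\sum_{k\in\mathbb Z}|\mathcal F(g)(k)|$, and $\mathcal F_\varphi(g)(\omega)=\int_0^1 g\,e^{-2\pi i\omega\bar\varphi}\,d\bar\varphi$ $(\omega\in\mathbb R)$. For $M_0\in\mathbb N$, $M_0\ge1$, let $V_{M_0}=\mathrm{span}\{e^{2\pi ikt}:|k|\le M_0\}$ and let $P_{V_{M_0}}$ be the orthogonal projection onto $V_{M_0}$. Let $\chi$ be the indicator function of $(-\tfrac12,\tfrac12)$. \textbf{Iteration.} Let $f=f_0+f_1\cos\theta$, where $f_0,f_1$ are continuous and $1$-periodic, $f_1>0$, and $\theta$ is a phase function with $\theta'>0$;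 let $L=L_\theta$. Given a phase function $\theta^0$ with $(\theta^0)'\in V_{M_0}$, the iterates are defined from $f$, $M_0$ and $\theta^0$ as follows. For $\varphi=\theta^m$ set \[ \tilde a=\sum_{k\in\mathbb Z}\chi(k/L_\varphi)\big[\mathcal F_\varphi(f)(k+L_\varphi)+\mathcal F_\varphi(f)(k-L_\varphi)\big]e^{2\pi ik\bar\varphi},\qquad \tilde b=\sum_{k\in\mathbb Z}\chi(k/L_\varphi)(-i)\big[\mathcal F_\varphi(f)(k+L_\varphi)-\mathcal F_\varphi(f)(k-L_\varphi)\big]e^{2\pi ik\bar\varphi}, \] \[ \Delta\varphi(t)=\int_0^t P_{V_{M_0}}\Big(\frac{d}{ds}\arctan\frac{\tilde b}{\tilde a}\Big)(s)\,ds,\qquad \theta^{m+1}=\theta^m+\beta\,\Delta\varphi, \] where $\beta$ is the largest $\alpha\in[0,1]$ such that $(\theta^m+\alpha\Delta\varphi)'\ge0$ everywhere. \textbf{Theorem.} Let $C_0>0$, $p\ge4$ be real, let $M_0\ge1$ be an integer, and let $f_1$ be a positive continuous $1$-periodic function. There are constants $\Gamma_0>0$ and $\eta_0>0$, determined by $C_0$,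 $p$, $M_0$ and $f_1$, such that the following holds for all $f_0,\theta,\theta^0$ as above. If \[ |\mathcal F(\theta')(k)|\le C_0|k|^{-p},\quad |\mathcal F_\theta(f_0)(k)|\le C_0|k|^{-p},\quad |\mathcal F_\theta(f_1)(k)|\le C_0|k|^{-p}\qquad\text{for all integers }k\ne0, \] if $L\ge\eta_0$, and if the initial guess satisfies $\|\mathcal F((\theta^0-\theta)')\|_1\le\pi M_0/2$, then for every $m\ge0$ \[ \|\mathcal F((\theta^{m+1}-\theta)')\|_1\le\Gamma_0\,(L/4)^{-p+2}+\tfrac12C_0M_0^{-p+1}+\tfrac12\|\mathcal F((\theta^m-\theta)')\|_1 . \] -/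

import Mathlib

open Real Complex MeasureTheory Set

noncomputable section

namespace PhaseRecovery

/-- A `C¹` phase function `φ` on the line for which `e^{iφ}` is `1`-periodic: over one period
the phase increases by an integer multiple of `2π`. -/
structure IsPhase (φ : ℝ → ℝ) : Prop where
  contDiff : ContDiff ℝ 1 φ
  quasiPeriodic : ∃ N : ℤ, ∀ t, φ (t + 1) = φ t + 2 * π * N

/-- The `k`-th Fourier coefficient over `[0,1]` (in the physical variable `t`) of a real function. -/
def coeff (g : ℝ → ℝ) (k : ℤ) : ℂ :=
  fourierCoeffOn (zero_lt_one : (0 : ℝ) < 1) (fun t => (g t : ℂ)) k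

/-- The `ℓ¹` norm of the sequence of Fourier coefficients, with values in `[0,∞]`. -/
def l1Norm (g : ℝ → ℝ) : ENNReal := ∑' k : ℤ, ‖coeff g k‖ₑ

/-- The trigonometric space `V_M = span {e^{2πikt} : -M ≤ k ≤ M}`. -/
def trigSpace (M : ℕ) : Submodule ℂ (ℝ → ℂ) :=
  Submodule.span ℂ
    ((fun (k : ℤ) (t : ℝ) => cexp (2 * π * I * k * t)) '' Set.Icc (-(M : ℤ)) (M : ℤ))

/-- The orthogonal projection of a real function onto `V_M`, i.e. truncation of its Fourier series
(the sum is real because `g` is). -/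
def trigProj (M : ℕ) (g : ℝ → ℝ) (t : ℝ) : ℝ :=
  (∑ k ∈ Finset.Icc (-(M : ℤ)) (M : ℤ), coeff g k * cexp (2 * π * I * k * t)).re

/-- `L_φ = (φ(1) - φ(0)) / 2π`, the number of periods. -/
def numPeriods (φ : ℝ → ℝ) : ℝ := (φ 1 - φ 0) / (2 * π)

/-- The normalized phase `φ̄ = (φ - φ(0)) / (2π L_φ)`. -/
def normPhase (φ : ℝ → ℝ) (t : ℝ) : ℝ := (φ t - φ 0) / (2 * π * numPeriods φ)

/-- The Fourier transform in the `φ`-space, `∫₀¹ g e^{-2πiωφ̄} dφ̄`. -/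
def phaseFourier (φ g : ℝ → ℝ) (ω : ℝ) : ℂ :=
  ∫ t in (0 : ℝ)..1,
    (g t : ℂ) * cexp (-(2 * π * I * ω * normPhase φ t)) * ((deriv (normPhase φ) t : ℝ) : ℂ)

/-- The inverse Fourier transform in the `φ`-space, `∑ₖ c(k) e^{2πikφ̄}`. It is only used below
for coefficients cut off to finitely many `k`. -/
def phaseFourierInv (φ : ℝ → ℝ) (c : ℤ → ℂ) (t : ℝ) : ℂ :=
  ∑' k : ℤ, c k * cexp (2 * π * I * k * normPhase φ t)

/-- The cutoff function `χ`, the indicator function of `(-1/2, 1/2)`. -/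
def cutoff (x : ℝ) : ℂ := (Set.Ioo (-(1 / 2) : ℝ) (1 / 2)).indicator (fun _ => (1 : ℂ)) x

/-- The computed envelope `ã` of `f` for the approximate phase `φ`. Its Fourier coefficients are
conjugate symmetric, so that the sum is real. -/
def envA (f φ : ℝ → ℝ) (t : ℝ) : ℝ :=
  (phaseFourierInv φ (fun k =>
    (phaseFourier φ f (k + numPeriods φ) + phaseFourier φ f (k - numPeriods φ))
      * cutoff (k / numPeriods φ)) t).re

/-- The computed envelope `b̃` of `f` for the approximate phase `φ`. -/
def envB (f φ : ℝ → ℝ) (t : ℝ) : ℝ :=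
  (phaseFourierInv φ (fun k =>
    -I * (phaseFourier φ f (k + numPeriods φ) - phaseFourier φ f (k - numPeriods φ))
      * cutoff (k / numPeriods φ)) t).re

/-- The increment of the frequency, `P_{V_M} (d/dt arctan(b̃/ã))`. Zeros of `ã` are harmless: `ã` is
a trigonometric polynomial in `φ̄`, so that it has finitely many zeros in a period (these do not
affect the Fourier coefficients of the pointwise derivative), or vanishes identically and then
`b̃/ã` has constant angle. -/
def freqIncrement (M : ℕ) (f φ : ℝ → ℝ) : ℝ → ℝ :=
  trigProj M (deriv fun t => Real.arctan (envB f φ t / envA f φ t))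

/-- The increment of the phase, `Δφ(t) = ∫₀ᵗ Δφ'(s) ds`. -/
def phaseIncrement (M : ℕ) (f φ : ℝ → ℝ) (t : ℝ) : ℝ :=
  ∫ s in (0 : ℝ)..t, freqIncrement M f φ s

/-- The step length, the largest `α ∈ [0,1]` for which `φ + α Δφ` is still nondecreasing. -/
def stepLength (M : ℕ) (f φ : ℝ → ℝ) : ℝ :=
  sSup {α : ℝ | α ∈ Set.Icc (0 : ℝ) 1 ∧
    ∀ t, 0 ≤ deriv (fun s => φ s + α * phaseIncrement M f φ s) t}

/-- One step of the iteration, `φ ↦ φ + β Δφ`. -/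
def phaseStep (M : ℕ) (f φ : ℝ → ℝ) (t : ℝ) : ℝ :=
  φ t + stepLength M f φ * phaseIncrement M f φ t

/-- The iterates `θ⁰, θ¹, θ², …` for the signal `f` and the initial guess `θ⁰ = φ₀`. -/
def phaseIter (M : ℕ) (f φ₀ : ℝ → ℝ) : ℕ → ℝ → ℝ
  | 0 => φ₀
  | m + 1 => phaseStep M f (phaseIter M f φ₀ m)

end PhaseRecovery

end

noncomputable section

namespace PhaseRecovery

/-! Let φ be an iterate and Δ = θ - (φ - φ(0)). Multiplying the signal by 2e^{-i(φ-φ(0))} gives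
f₁e^{iΔ}, plus a term with f₀ displaced by one carrier frequency and a term with f₁e^{-iΔ} displaced
by two. The computed envelope ã + ib̃ is the low-pass part of this product in the variable φ̄
(`env_eq`, `two_mul_circCoeff_eq`), so it is f₁e^{iΔ} up to the high frequencies of f₀, f₁e^{iΔ} and
f₁e^{-iΔ}.

These high frequencies are small by analytic continuation. φ' is a trigonometric polynomial of fixed
degree, and cutting the series of θ', f₀ and f₁ at frequency L/(4p) costs O(L^{1-p}) and leaves
entire functions (`norm_mul_cexp_sub_entireApprox_le`). On a strip of half-width of order log L / L
the retained coefficients are amplified by at most a multiple of k², which the decay |k|^{-p} with p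
≥ 4 absorbs, so the entire functions stay bounded (`norm_entireApprox_le`). Moving the contour to
the edge of the strip yields |k|^{-p} for |k| ≥ L/4 (`norm_circCoeff_entireApprox_le`). Summation
over the O(L) frequencies of the filter gives ã + ib̃ = f₁e^{iΔ} + O(L^{2-p}) (`norm_envC_sub_le`).

Rotated back by Δ, the envelope curve therefore lies in a thin sector around the positive axis,
because f₁ is bounded below. Its angle differs from Δ by a small periodic function, and integration
by parts shows that the frequencies up to M₀ of (arctan(b̃/ã))' are those of Δ' up to O(L^{2-p}),
with exact agreement at frequency 0 (`norm_coeff_deriv_arctan_sub_le`).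

A full step thus corrects the low frequencies up to O(L^{2-p}). Nothing above M₀ is ever present in
an iterate, so the rest of the error is the tail of θ' (`phaseStep_isNear`). The tail is at most
C₀M₀^{1-p} by decay, and at most the previous error because it is part of that error; the mean of
the two bounds is the assertion. The initial guess bounds the tail by πM₀/2, which keeps all
iterates in one fixed ball, where the phases stay increasing and every step length is 1. -/

/-! ### Sums of powers over integer frequencies. -/

/-- The tail of the power sequence, `|k|^{-s}` for `|k| ≥ N` and `0` otherwise. -/
def powTail (N s : ℝ) (k : ℤ) : ℝ := if N ≤ |(k : ℝ)| then |(k : ℝ)| ^ (-s) else 0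

lemma powTail_nonneg (N s : ℝ) (k : ℤ) : 0 ≤ powTail N s k := by
  unfold powTail; split_ifs <;> positivity

lemma summable_tsum_le_of_even {f : ℤ → ℝ} {b : ℝ} (hf : ∀ k, 0 ≤ f k) (h0 : f 0 = 0)
    (heven : ∀ k, f (-k) = f k) (hb : ∀ m : ℕ, ∑ n ∈ Finset.range m, f n ≤ b) :
    Summable f ∧ ∑' k, f k ≤ 2 * b := by
  have hs : Summable fun n : ℕ => f n :=
    summable_of_sum_range_le (fun n => hf n) hb
  have ht : ∑' n : ℕ, f n ≤ b := Real.tsum_le_of_sum_range_le (fun n => hf n) hb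
  have hs' : Summable fun n : ℕ => f (-(n : ℤ)) := by simpa only [heven] using hs
  have hS : Summable f := Summable.of_nat_of_neg hs hs'
  refine ⟨hS, ?_⟩
  rw [Summable.tsum_of_nat_of_neg hs hs', h0]
  simp only [heven]
  linarith

lemma sum_range_powTail_two_le {N : ℝ} (hN : 1 ≤ N) (m : ℕ) :
    ∑ n ∈ Finset.range m, powTail N 2 (n : ℤ) ≤ 2 / N := by
  have hc : 1 ≤ ⌈N⌉₊ := Nat.one_le_ceil_iff.2 (by linarith)
  calc ∑ n ∈ Finset.range m, powTail N 2 (n : ℤ)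
      = ∑ n ∈ Finset.Ioo (⌈N⌉₊ - 1) m, ((n : ℝ) ^ 2)⁻¹ := by
        unfold powTail
        rw [← Finset.sum_filter]
        refine Finset.sum_congr ?_ fun n _ => ?_
        · ext n
          simp only [Finset.mem_filter, Finset.mem_range, Finset.mem_Ioo, Int.cast_natCast,
            Nat.abs_cast]
          rw [← Nat.ceil_le]
          omega
        · rw [Int.cast_natCast, Nat.abs_cast, Real.rpow_neg (by positivity)]
          norm_num
    _ ≤ 2 / (((⌈N⌉₊ - 1 : ℕ) : ℝ) + 1) := sum_Ioo_inv_sq_le _ _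
    _ ≤ 2 / N := by
        rw [Nat.cast_sub hc]
        have := Nat.le_ceil N
        gcongr
        push_cast
        linarith

/-- On |k| ≥ N the factor |k|^{s'-s} is largest at N. This reduces all exponents to s' = 2 or s' =
3, where the sums are computed by hand. -/
lemma powTail_le {N s s' : ℝ} (hN : 1 ≤ N) (hs : s' ≤ s) (k : ℤ) :
    powTail N s k ≤ N ^ (s' - s) * powTail N s' k := by
  unfold powTail
  split_ifs with h
  · have hk : 0 < |(k : ℝ)| := by linarith
    have : |(k : ℝ)| ^ (-s) = |(k : ℝ)| ^ (s' - s) * |(k : ℝ)| ^ (-s') := by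
      rw [← Real.rpow_add hk]; ring_nf
    rw [this]
    gcongr ?_ * _
    exact Real.rpow_le_rpow_of_nonpos (by linarith) h (by linarith)
  · simp

lemma powTail_neg (N s : ℝ) (k : ℤ) : powTail N s (-k) = powTail N s k := by
  simp [powTail]

lemma powTail_zero {N : ℝ} (hN : 1 ≤ N) (s : ℝ) : powTail N s 0 = 0 := by
  unfold powTail
  rw [if_neg]
  simp only [Int.cast_zero, abs_zero, not_le]
  linarith

lemma summable_powTail {N s : ℝ} (hN : 1 ≤ N) (hs : 2 ≤ s) :
    Summable (powTail N s) ∧ ∑' k, powTail N s k ≤ 4 * N ^ (1 - s) := by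
  have := summable_tsum_le_of_even (f := powTail N s) (b := N ^ (2 - s) * (2 / N))
    (powTail_nonneg N s) (powTail_zero hN s) (powTail_neg N s) (fun m => by
      calc _ ≤ ∑ n ∈ Finset.range m, N ^ (2 - s) * powTail N 2 (n : ℤ) :=
            Finset.sum_le_sum fun n _ => powTail_le hN hs n
        _ ≤ _ := by
            rw [← Finset.mul_sum]
            gcongr
            exact sum_range_powTail_two_le hN m)
  refine ⟨this.1, this.2.trans (le_of_eq ?_)⟩
  have : N ^ (2 - s) = N ^ (1 - s) * N := by
    rw [← Real.rpow_add_one (by positivity)]; ring_nf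
  rw [this]
  field_simp
  norm_num

lemma sum_powTail_le {N s : ℝ} (hN : 1 ≤ N) (hs : 2 ≤ s) (S : Finset ℤ) :
    ∑ k ∈ S, powTail N s k ≤ 4 * N ^ (1 - s) :=
  ((summable_powTail hN hs).1.sum_le_tsum S fun k _ => powTail_nonneg N s k).trans
    (summable_powTail hN hs).2

/-- Since (n-1)n(n+1) ≤ n³, the sum is dominated by a telescoping one. The sharp factor 1/2 makes
the two-sided tail at most M^{-2}, and this is why C₀M₀^{1-p} enters the theorem with no further
constant. -/
lemma sum_range_powTail_three_le {M : ℕ} (hM : 1 ≤ M) (m : ℕ) :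
    ∑ n ∈ Finset.range m, powTail (M + 1) 3 (n : ℤ) ≤ 1 / (2 * (M : ℝ) ^ 2) := by
  have hM' : (1 : ℝ) ≤ M := by exact_mod_cast hM
  -- The `else` value makes the right side vanish while the range has not reached M + 1, so that the
  -- induction starts at 0 and then telescopes.
  have key : ∀ m : ℕ, ∑ n ∈ Finset.range m, powTail (M + 1) 3 (n : ℤ) ≤
      1 / (2 * (M : ℝ) * (M + 1)) - (if M + 1 ≤ m then 1 / (2 * ((m : ℝ) - 1) * m)
        else 1 / (2 * (M : ℝ) * (M + 1))) := by
    intro m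
    induction m with
    | zero => simp
    | succ m ih =>
      rw [Finset.sum_range_succ]
      refine (add_le_add_left ih _).trans ?_
      unfold powTail
      have hiff : ((M : ℝ) + 1 ≤ |((m : ℤ) : ℝ)|) ↔ M + 1 ≤ m := by
        rw [Int.cast_natCast, Nat.abs_cast]; exact_mod_cast Iff.rfl
      simp only [hiff]
      by_cases h : M + 1 ≤ m
      · rw [if_pos h, if_pos h, if_pos (by omega)]
        have hm : (2 : ℝ) ≤ m := by exact_mod_cast (by omega : 2 ≤ m)
        rw [Int.cast_natCast, Nat.abs_cast, Real.rpow_neg (by positivity)]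
        have e : ((m : ℝ) ^ (3 : ℝ)) = (m : ℝ) ^ 3 := by exact_mod_cast Real.rpow_natCast (m : ℝ) 3
        rw [e]
        push_cast
        have h1 : 0 < (m : ℝ) - 1 := by linarith
        have e2 : 1 / (2 * ((m : ℝ) - 1) * m) - 1 / (2 * ((m : ℝ) + 1 - 1) * (m + 1)) =
            1 / (((m : ℝ) - 1) * m * (m + 1)) := by
          rw [add_sub_cancel_right]
          have h2 : (m : ℝ) ≠ 0 := by positivity
          have h3 : (m : ℝ) + 1 ≠ 0 := by positivity
          field_simp [h1.ne']
          ring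
        have e3 : ((m : ℝ) ^ 3)⁻¹ ≤ 1 / (((m : ℝ) - 1) * m * (m + 1)) := by
          rw [inv_eq_one_div]
          apply one_div_le_one_div_of_le (by positivity)
          nlinarith
        linarith
      · rw [if_neg h, if_neg h]
        by_cases h' : M + 1 ≤ m + 1
        · rw [if_pos h']
          have : m = M := by omega
          subst this
          push_cast
          apply le_of_eq
          ring_nf
        · rw [if_neg h']; simp
  refine (key m).trans ?_
  have h1 : 1 / (2 * (M : ℝ) * (M + 1)) ≤ 1 / (2 * (M : ℝ) ^ 2) := by
    apply one_div_le_one_div_of_le (by positivity); nlinarith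
  split_ifs with h
  · have hm : (2 : ℝ) ≤ m := by exact_mod_cast (by omega : 2 ≤ m)
    have : 0 ≤ 1 / (2 * ((m : ℝ) - 1) * m) := by
      have : 0 < (m : ℝ) - 1 := by linarith
      positivity
    linarith
  · rw [sub_self]; positivity

lemma summable_powTail_succ {M : ℕ} (hM : 1 ≤ M) {s : ℝ} (hs : 3 ≤ s) :
    Summable (powTail (M + 1) s) ∧ ∑' k, powTail (M + 1) s k ≤ (M : ℝ) ^ (1 - s) := by
  have hM' : (1 : ℝ) ≤ M := by exact_mod_cast hM
  have := summable_tsum_le_of_even (f := powTail (M + 1) s)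
    (b := (M : ℝ) ^ (3 - s) * (1 / (2 * (M : ℝ) ^ 2)))
    (powTail_nonneg _ s) (powTail_zero (by linarith) s) (powTail_neg _ s) (fun m => by
      calc _ ≤ ∑ n ∈ Finset.range m, (M : ℝ) ^ (3 - s) * powTail (M + 1) 3 (n : ℤ) := by
            refine Finset.sum_le_sum fun n _ => (powTail_le (by linarith) hs n).trans ?_
            refine mul_le_mul_of_nonneg_right ?_ (powTail_nonneg _ _ _)
            exact Real.rpow_le_rpow_of_nonpos (by linarith) (by linarith) (by linarith)
        _ ≤ _ := by
            rw [← Finset.mul_sum]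
            gcongr
            exact sum_range_powTail_three_le hM m)
  refine ⟨this.1, this.2.trans (le_of_eq ?_)⟩
  have : (M : ℝ) ^ (3 - s) = (M : ℝ) ^ (1 - s) * (M : ℝ) ^ 2 := by
    rw [← Real.rpow_add_natCast (by positivity)]; ring_nf
  rw [this]
  field_simp

/-! ### Exponential weights of width log L / L against powers. -/

/-- The function log x / x decreases on [e, ∞), so log L / L may be replaced by its value at k/ε ≤
L. A weight of rate log L / L then costs only a power of k. -/
lemma exp_mul_le_of_le {ε c L k : ℝ} (hε : 0 < ε) (h1 : rexp 1 ≤ k / ε) (hk : k ≤ ε * L)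
    (hc : 0 ≤ c) : rexp (c * k * Real.log L / L) ≤ (k / ε) ^ (c * ε) := by
  have h2 : k / ε ≤ L := by rw [div_le_iff₀ hε]; linarith
  have h3 := Real.log_div_self_antitoneOn (mem_Ici.2 h1) (mem_Ici.2 (h1.trans h2)) h2
  have hkε : 0 < k / ε := (Real.exp_pos 1).trans_le h1
  have hk0 : 0 < k := by have := mul_pos hkε hε; rwa [div_mul_cancel₀ _ hε.ne'] at this
  rw [Real.rpow_def_of_pos hkε, Real.exp_le_exp]
  simp only at h3
  calc c * k * Real.log L / L = c * k * (Real.log L / L) := by ring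
    _ ≤ c * k * (Real.log (k / ε) / (k / ε)) := by gcongr
    _ = Real.log (k / ε) * (c * ε) := by field_simp

/-- The same monotonicity in the opposite direction, between L and 4k ≥ L: beyond L/4 the weight
gains a full power of k. -/
lemma exp_neg_mul_le_of_le {c L k : ℝ} (h1 : rexp 1 ≤ L) (hk : L ≤ 4 * k) (hc : 0 ≤ c) :
    rexp (-(4 * c * k * Real.log L / L)) ≤ k ^ (-c) := by
  have h3 := Real.log_div_self_antitoneOn (mem_Ici.2 h1) (mem_Ici.2 (h1.trans hk)) hk
  have hL : 0 < L := (Real.exp_pos 1).trans_le h1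
  have hk0 : 0 < k := by linarith
  rw [Real.rpow_def_of_pos hk0, Real.exp_le_exp]
  simp only at h3
  have h4 : Real.log k ≤ Real.log (4 * k) := Real.log_le_log hk0 (by linarith)
  have : 4 * c * k * (Real.log (4 * k) / (4 * k)) ≤ 4 * c * k * (Real.log L / L) := by gcongr
  have e : 4 * c * k * (Real.log (4 * k) / (4 * k)) = c * Real.log (4 * k) := by field_simp
  rw [e] at this
  have e2 : 4 * c * k * Real.log L / L = 4 * c * k * (Real.log L / L) := by ring
  rw [e2]
  nlinarith

/-! ### Fourier series in the variable q(t) on the circle. -/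

/-- A `C¹` diffeomorphism of the line that induces a diffeomorphism of the circle `ℝ/ℤ` fixing `0`,
with derivative between `1/2` and `2`. -/
structure IsCircleDiffeo (q : ℝ → ℝ) : Prop where
  contDiff : ContDiff ℝ 1 q
  map_zero : q 0 = 0
  map_add_one : ∀ t, q (t + 1) = q t + 1
  le_deriv : ∀ t, 1 / 2 ≤ deriv q t
  deriv_le : ∀ t, deriv q t ≤ 2

/-- The Fourier coefficients with respect to the variable `q(t)`. -/
def circCoeff (q : ℝ → ℝ) (g : ℝ → ℂ) (k : ℤ) : ℂ :=
  ∫ t in (0 : ℝ)..1, g t * cexp (-(2 * π * I * k * q t)) * ((deriv q t : ℝ) : ℂ)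

namespace IsCircleDiffeo

variable {q : ℝ → ℝ}

lemma continuous (hq : IsCircleDiffeo q) : Continuous q := hq.contDiff.continuous

lemma continuous_deriv (hq : IsCircleDiffeo q) : Continuous (deriv q) :=
  hq.contDiff.continuous_deriv le_rfl

lemma hasDerivAt (hq : IsCircleDiffeo q) (t : ℝ) : HasDerivAt q (deriv q t) t :=
  (hq.contDiff.differentiable one_ne_zero t).hasDerivAt

lemma map_one (hq : IsCircleDiffeo q) : q 1 = 1 := by
  simpa [hq.map_zero] using hq.map_add_one 0

lemma map_add_int (hq : IsCircleDiffeo q) (t : ℝ) (n : ℤ) : q (t + n) = q t + n := by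
  have h : Function.Periodic (fun t => q t - t) 1 := fun t => by
    simp only [hq.map_add_one]; ring
  have := h.int_mul n t
  simp only [mul_one] at this
  linarith

lemma strictMono (hq : IsCircleDiffeo q) : StrictMono q :=
  strictMono_of_deriv_pos fun t => by linarith [hq.le_deriv t]

lemma surjective (hq : IsCircleDiffeo q) : Function.Surjective q := by
  intro y
  have h0 : ∀ n : ℤ, q n = n := fun n => by simpa [hq.map_zero] using hq.map_add_int 0 n
  have h := intermediate_value_Icc (a := (⌊y⌋ : ℝ)) (b := ((⌊y⌋ + 1 : ℤ) : ℝ))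
    (by push_cast; linarith) hq.continuous.continuousOn
  rw [h0, h0] at h
  obtain ⟨x, -, hx⟩ := h ⟨Int.floor_le y, by push_cast; exact (Int.lt_floor_add_one y).le⟩
  exact ⟨x, hx⟩

lemma exists_inverse (hq : IsCircleDiffeo q) : ∃ r : ℝ → ℝ, Continuous r ∧
    (∀ x, q (r x) = x) ∧ (∀ t, r (q t) = t) ∧ ∀ x, r (x + 1) = r x + 1 := by
  let e := hq.strictMono.orderIsoOfSurjective q hq.surjective
  have h1 : ∀ x, q (e.symm x) = x := fun x => e.apply_symm_apply x
  have h2 : ∀ t, e.symm (q t) = t := fun t => e.symm_apply_apply t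
  refine ⟨e.symm, e.symm.continuous, h1, h2, fun x => ?_⟩
  have := hq.map_add_one (e.symm x)
  rw [h1] at this
  rw [← this, h2]

lemma norm_circCoeff_le (hq : IsCircleDiffeo q) {g : ℝ → ℂ} {B : ℝ}
    (hB : ∀ t ∈ Icc (0 : ℝ) 1, ‖g t‖ ≤ B) (k : ℤ) : ‖circCoeff q g k‖ ≤ 2 * B := by
  have := intervalIntegral.norm_integral_le_of_norm_le_const (a := 0) (b := 1) (C := 2 * B)
    (f := fun t => g t * cexp (-(2 * π * I * k * q t)) * ((deriv q t : ℝ) : ℂ)) (fun t ht => by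
      rw [uIoc_of_le zero_le_one] at ht
      have hg := hB t (Ioc_subset_Icc_self ht)
      have he : ‖cexp (-(2 * π * I * k * q t))‖ = 1 := by
        rw [show -(2 * π * I * k * q t) = ((-(2 * π * k * q t) : ℝ) : ℂ) * I by push_cast; ring]
        exact Complex.norm_exp_ofReal_mul_I _
      rw [norm_mul, norm_mul, he, mul_one, Complex.norm_real, Real.norm_eq_abs,
        abs_of_pos (by linarith [hq.le_deriv t]), mul_comm 2 B]
      have := hq.deriv_le t
      have h0 := (norm_nonneg _).trans hg
      have := hq.le_deriv t
      gcongr)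
  simpa [circCoeff] using this

lemma continuous_integrand (hq : IsCircleDiffeo q) {g : ℝ → ℂ} (hg : Continuous g) (k : ℤ) :
    Continuous fun t => g t * cexp (-(2 * π * I * k * q t)) * ((deriv q t : ℝ) : ℂ) := by
  have := hq.continuous
  have := hq.continuous_deriv
  fun_prop

lemma circCoeff_add (hq : IsCircleDiffeo q) {g h : ℝ → ℂ} (hg : Continuous g) (hh : Continuous h)
    (k : ℤ) : circCoeff q (fun t => g t + h t) k = circCoeff q g k + circCoeff q h k := by
  unfold circCoeff
  rw [← intervalIntegral.integral_add
    ((hq.continuous_integrand hg k).intervalIntegrable _ _)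
    ((hq.continuous_integrand hh k).intervalIntegrable _ _)]
  congr 1; ext t; ring

lemma circCoeff_sub (hq : IsCircleDiffeo q) {g h : ℝ → ℂ} (hg : Continuous g) (hh : Continuous h)
    (k : ℤ) : circCoeff q (fun t => g t - h t) k = circCoeff q g k - circCoeff q h k := by
  unfold circCoeff
  rw [← intervalIntegral.integral_sub
    ((hq.continuous_integrand hg k).intervalIntegrable _ _)
    ((hq.continuous_integrand hh k).intervalIntegrable _ _)]
  congr 1; ext t; ring

lemma circCoeff_eq_integral (hq : IsCircleDiffeo q) {r : ℝ → ℝ} (hr : Continuous r)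
    (hrq : ∀ t, r (q t) = t) {g : ℝ → ℂ} (hg : Continuous g) (k : ℤ) :
    circCoeff q g k = ∫ x in (0 : ℝ)..1, g (r x) * cexp (-(2 * π * I * k * x)) := by
  have := intervalIntegral.integral_deriv_smul_comp (a := 0) (b := 1) (f := q) (f' := deriv q)
    (g := fun x => g (r x) * cexp (-(2 * π * I * k * x))) (fun t _ => hq.hasDerivAt t)
    hq.continuous_deriv.continuousOn (by fun_prop)
  rw [hq.map_zero, hq.map_one] at this
  rw [← this]
  unfold circCoeff
  congr 1; ext t
  simp only [Function.comp_apply, hrq, Complex.real_smul]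
  ring

/-- Composition with the inverse of q turns these coefficients into ordinary ones of a continuous
function on the circle, where summability implies pointwise convergence. -/
lemma hasSum (hq : IsCircleDiffeo q) {g : ℝ → ℂ} (hg : Continuous g)
    (hper : Function.Periodic g 1) (hs : Summable (circCoeff q g)) (t : ℝ) :
    HasSum (fun k : ℤ => circCoeff q g k * cexp (2 * π * I * k * q t)) (g t) := by
  obtain ⟨r, hr, -, hrq, hr1⟩ := hq.exists_inverse
  have hG : Function.Periodic (fun x => g (r x)) (1 : ℝ) := fun x => by
    simp only [hr1]; exact hper _
  have hGc : Continuous hG.lift := continuous_coinduced_dom.2 (hg.comp hr)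
  let G : C(AddCircle (1 : ℝ), ℂ) := ⟨hG.lift, hGc⟩
  have hcoe : ∀ k, fourierCoeff G k = circCoeff q g k := fun k => by
    rw [hq.circCoeff_eq_integral hr hrq hg, fourierCoeff_eq_intervalIntegral _ _ 0]
    simp only [div_one, one_smul, zero_add]
    congr 1; ext x
    have : G (x : AddCircle (1 : ℝ)) = g (r x) := rfl
    rw [this, fourier_coe_apply, smul_eq_mul, mul_comm]
    congr 2
    push_cast
    ring
  have := has_pointwise_sum_fourier_series_of_summable (f := G)
    (by simpa only [funext hcoe] using hs) (q t : AddCircle (1 : ℝ))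
  have hGt : G (q t : AddCircle (1 : ℝ)) = g t := by
    change g (r (q t)) = g t
    rw [hrq]
  rw [hGt] at this
  convert this using 2 with k
  rw [hcoe, fourier_coe_apply, smul_eq_mul]
  congr 2
  push_cast
  ring

/-- A function whose Fourier coefficients have a summable majorant off a finite set of frequencies
is close to the corresponding partial sum. -/
lemma norm_sub_sum_le (hq : IsCircleDiffeo q) {g : ℝ → ℂ} (hg : Continuous g)
    (hper : Function.Periodic g 1) {S : Finset ℤ} {b : ℤ → ℝ} (hb : Summable b)
    (hgb : ∀ k ∉ S, ‖circCoeff q g k‖ ≤ b k) (hb0 : ∀ k, 0 ≤ b k) (t : ℝ) :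
    ‖g t - ∑ k ∈ S, circCoeff q g k * cexp (2 * π * I * k * q t)‖ ≤ ∑' k, b k := by
  have he : ∀ k : ℤ, ‖cexp (2 * π * I * k * q t)‖ = 1 := fun k => by
    rw [show (2 * π * I * k * q t : ℂ) = ((2 * π * k * q t : ℝ) : ℂ) * I by push_cast; ring]
    exact Complex.norm_exp_ofReal_mul_I _
  have hs : Summable (circCoeff q g) :=
    S.summable_compl_iff.1 (Summable.of_norm_bounded (g := fun k : {k // k ∉ S} => b k)
      (hb.subtype _) fun k => hgb k k.2)
  have h := hq.hasSum hg hper hs t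
  have h2 := S.hasSum_compl_iff.2 (show HasSum _ ((g t - ∑ k ∈ S, circCoeff q g k *
    cexp (2 * π * I * k * q t)) + ∑ k ∈ S, circCoeff q g k * cexp (2 * π * I * k * q t)) by
      rw [sub_add_cancel]; exact h)
  have hb' : Summable fun k : {k // k ∉ S} => b k := hb.subtype _
  refine (h2.norm_le_of_bounded hb'.hasSum fun k => ?_).trans ?_
  · rw [norm_mul, he, mul_one]
    exact hgb k k.2
  · exact hb.tsum_subtype_le _ _ hb0

end IsCircleDiffeo

/-! ### Contour shift and trigonometric polynomials of a complex variable. -/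

/-- Cauchy's theorem on a rectangle of width one period: the vertical sides cancel. -/
lemma integral_eq_integral_add_mul_I {G : ℂ → ℂ} (hG : Differentiable ℂ G)
    (hper : ∀ z, G (z + 1) = G z) (s : ℝ) :
    ∫ t in (0 : ℝ)..1, G t = ∫ t in (0 : ℝ)..1, G (t + s * I) := by
  have h := Complex.integral_boundary_rect_eq_zero_of_differentiableOn G 0 (1 + s * I)
    hG.differentiableOn
  simp only [zero_re, zero_im, add_re, add_im, one_re, one_im, mul_re, mul_im, ofReal_re, ofReal_im,
    I_re, I_im, mul_zero, mul_one, zero_mul, add_zero, zero_add, ofReal_zero,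
    ofReal_one, sub_self] at h
  have e : ∀ y : ℝ, G (1 + y * I) = G (y * I) := fun y => by rw [add_comm, hper]
  simp only [e] at h
  rw [add_sub_cancel_right] at h
  exact sub_eq_zero.1 h

/-- The trigonometric polynomial with coefficients `a k`, `|k| ≤ N`. -/
def trigPoly (a : ℤ → ℂ) (N : ℕ) (z : ℂ) : ℂ :=
  ∑ k ∈ Finset.Icc (-(N : ℤ)) N, a k * cexp (2 * π * I * k * z)

/-- The primitive of `trigPoly a N` that vanishes at `0`. -/
def trigPrim (a : ℤ → ℂ) (N : ℕ) (z : ℂ) : ℂ :=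
  a 0 * z + ∑ k ∈ (Finset.Icc (-(N : ℤ)) N).erase 0,
    a k * ((cexp (2 * π * I * k * z) - 1) / (2 * π * I * k))

lemma cexp_add_one (k : ℤ) (z : ℂ) :
    cexp (2 * π * I * k * (z + 1)) = cexp (2 * π * I * k * z) := by
  rw [mul_add, Complex.exp_add, show (2 * π * I * k * 1 : ℂ) = k * (2 * π * I) by ring,
    Complex.exp_int_mul_two_pi_mul_I, mul_one]

lemma zero_mem_Icc (N : ℕ) : (0 : ℤ) ∈ Finset.Icc (-(N : ℤ)) N := by simp

lemma abs_le_of_mem_Icc {N : ℕ} {k : ℤ} (hk : k ∈ Finset.Icc (-(N : ℤ)) N) :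
    |(k : ℝ)| ≤ N := by
  rw [Finset.mem_Icc, ← abs_le] at hk
  exact_mod_cast hk

lemma one_le_abs_intCast {k : ℤ} (hk : k ≠ 0) : (1 : ℝ) ≤ |(k : ℝ)| := by
  exact_mod_cast Int.one_le_abs hk

lemma two_pi_I_mul_ne_zero {k : ℤ} (hk : k ≠ 0) : (2 * π * I * k : ℂ) ≠ 0 := by
  simp [Real.pi_ne_zero, hk]

lemma trigPrim_add_one (a : ℤ → ℂ) (N : ℕ) (z : ℂ) :
    trigPrim a N (z + 1) = trigPrim a N z + a 0 := by
  unfold trigPrim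
  simp only [cexp_add_one]
  ring

lemma trigPoly_add_one (a : ℤ → ℂ) (N : ℕ) (z : ℂ) :
    trigPoly a N (z + 1) = trigPoly a N z := by
  unfold trigPoly
  simp only [cexp_add_one]

@[simp] lemma trigPrim_zero (a : ℤ → ℂ) (N : ℕ) : trigPrim a N 0 = 0 := by
  simp [trigPrim]

lemma hasDerivAt_trigPrim (a : ℤ → ℂ) (N : ℕ) (z : ℂ) :
    HasDerivAt (trigPrim a N) (trigPoly a N z) z := by
  have h : trigPoly a N z = a 0 * 1 + ∑ k ∈ (Finset.Icc (-(N : ℤ)) N).erase 0,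
      a k * cexp (2 * π * I * k * z) := by
    unfold trigPoly
    rw [← Finset.add_sum_erase _ _ (zero_mem_Icc N)]
    simp
  rw [h]
  refine ((hasDerivAt_id z).const_mul (a 0)).add (HasDerivAt.fun_sum fun k hk => ?_)
  have hk0 := two_pi_I_mul_ne_zero (Finset.mem_erase.1 hk).1
  have h1 : HasDerivAt (fun z : ℂ => cexp (2 * π * I * k * z))
      (cexp (2 * π * I * k * z) * (2 * π * I * k * 1)) z :=
    ((hasDerivAt_id z).const_mul (2 * π * I * k : ℂ)).cexp
  refine (((h1.sub_const 1).div_const (2 * π * I * k : ℂ)).const_mul (a k)).congr_deriv ?_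
  rw [mul_one, mul_div_cancel_right₀ _ hk0]

lemma differentiable_trigPrim (a : ℤ → ℂ) (N : ℕ) : Differentiable ℂ (trigPrim a N) :=
  fun z => (hasDerivAt_trigPrim a N z).differentiableAt

lemma differentiable_trigPoly (a : ℤ → ℂ) (N : ℕ) : Differentiable ℂ (trigPoly a N) := by
  unfold trigPoly; fun_prop

lemma norm_cexp_two_pi_mul (k : ℤ) (z : ℂ) :
    ‖cexp (2 * π * I * k * z)‖ = rexp (-(2 * π * k * z.im)) := by
  rw [Complex.norm_exp]
  congr 1
  simp [mul_re, mul_im]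

lemma norm_cexp_two_pi_mul_le (k : ℤ) (z : ℂ) :
    ‖cexp (2 * π * I * k * z)‖ ≤ rexp (2 * π * |(k : ℝ)| * |z.im|) := by
  rw [norm_cexp_two_pi_mul]
  apply Real.exp_le_exp.2
  calc -(2 * π * k * z.im) ≤ |-(2 * π * k * z.im)| := le_abs_self _
    _ = _ := by rw [abs_neg, abs_mul, abs_mul, abs_of_pos (by positivity : 0 < 2 * π)]

lemma norm_trigPrim_sub_le (a : ℤ → ℂ) (N : ℕ) {b : ℤ → ℝ} (z : ℂ)
    (hb : ∀ k ∈ Finset.Icc (-(N : ℤ)) N, k ≠ 0 →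
      ‖a k‖ * rexp (2 * π * |(k : ℝ)| * |z.im|) ≤ b k) :
    ‖trigPrim a N z - a 0 * z‖ ≤ ∑ k ∈ (Finset.Icc (-(N : ℤ)) N).erase 0, b k := by
  unfold trigPrim
  rw [add_sub_cancel_left]
  refine norm_sum_le_of_le _ fun k hk => ?_
  obtain ⟨hk0, hk⟩ := Finset.mem_erase.1 hk
  refine le_trans ?_ (hb k hk hk0)
  rw [norm_mul]
  gcongr
  rw [norm_div]
  -- The divisor 2πik is at least 2 in modulus and pays for the factor 2 in |e^w - 1| ≤ W + 1 ≤ 2W,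
  -- where W ≥ 1 is the weight.
  have h1 : (2 : ℝ) ≤ ‖(2 * π * I * k : ℂ)‖ := by
    have := one_le_abs_intCast hk0
    simp only [norm_mul, Complex.norm_ofNat, Complex.norm_real, norm_I, Complex.norm_intCast,
      mul_one, Real.norm_eq_abs, abs_of_pos Real.pi_pos]
    nlinarith [Real.pi_gt_three]
  have h2 := norm_cexp_two_pi_mul_le k z
  have h3 : 1 ≤ rexp (2 * π * |(k : ℝ)| * |z.im|) := Real.one_le_exp (by positivity)
  have h4 := norm_sub_le (cexp (2 * π * I * k * z)) 1
  rw [norm_one] at h4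
  rw [div_le_iff₀ (by linarith)]
  nlinarith

/-! ### Bounds for the approximating entire functions in the strip. -/

/-- The half-width of the strip to which the contours of integration are shifted. -/
def stripWidth (p L : ℝ) : ℝ := 4 * p * Real.log L / (π * L)

lemma stripWidth_nonneg {p L : ℝ} (hp : 4 ≤ p) (hL : rexp 1 ≤ L) : 0 ≤ stripWidth p L := by
  have h1 : 1 ≤ L := (Real.one_le_exp zero_le_one).trans hL
  have := Real.log_nonneg h1
  have := Real.pi_pos
  unfold stripWidth
  positivity

lemma stripWidth_le {p L : ℝ} (hp : 4 ≤ p) (hL : rexp 1 ≤ L) : stripWidth p L ≤ 4 * p := by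
  have h1 : 1 ≤ L := (Real.one_le_exp zero_le_one).trans hL
  have h2 := Real.log_le_self (by linarith : 0 ≤ L)
  have h3 := Real.log_nonneg h1
  have := Real.pi_gt_three
  unfold stripWidth
  rw [div_le_iff₀ (by positivity)]
  have : Real.log L ≤ π * L := by nlinarith
  nlinarith

/-- At the edge of the strip the exponent is 8pk log L / L. For k ≤ L/(4p) the exponent of the
resulting power is 8p · 1/(4p) = 2; the cutoff at L/(4p) is chosen for this. -/
lemma exp_weight_le {p L k s : ℝ} (hp : 4 ≤ p) (hL : rexp 1 ≤ L) (hk1 : 1 ≤ k)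
    (hk : 4 * p * k ≤ L) (hs : |s| ≤ stripWidth p L) :
    rexp (2 * π * k * |s|) ≤ (4 * p * k) ^ 2 := by
  have hL0 : 0 < L := (Real.exp_pos 1).trans_le hL
  have h := exp_mul_le_of_le (ε := 1 / (4 * p)) (c := 8 * p) (L := L) (k := k) (by positivity)
    (by
      have := Real.exp_one_lt_d9
      rw [div_div_eq_mul_div, div_one]
      nlinarith)
    (by rw [one_div, inv_mul_eq_div, le_div_iff₀ (by positivity)]; linarith) (by positivity)
  have e1 : k / (1 / (4 * p)) = 4 * p * k := by field_simp
  have e2 : 8 * p * (1 / (4 * p)) = 2 := by field_simp; norm_num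
  rw [e1, e2] at h
  have e3 : (4 * p * k) ^ (2 : ℝ) = (4 * p * k) ^ 2 := by exact_mod_cast Real.rpow_natCast _ 2
  rw [e3] at h
  refine le_trans (Real.exp_le_exp.2 ?_) h
  calc 2 * π * k * |s| ≤ 2 * π * k * stripWidth p L := by gcongr
    _ = _ := by
      unfold stripWidth
      have := Real.pi_ne_zero
      field_simp
      ring

/-- The weight consumes two powers of the decay. The remaining exponent p - 2 must be at least 2 for
the sums used below, which is where p ≥ 4 is needed. -/
lemma weighted_coeff_le {C p L s x : ℝ} {k : ℤ} (hC : 0 ≤ C) (hp : 4 ≤ p) (hL : rexp 1 ≤ L)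
    (hk0 : k ≠ 0) (hk : 4 * p * |(k : ℝ)| ≤ L) (hs : |s| ≤ stripWidth p L)
    (hx : x ≤ C * |(k : ℝ)| ^ (-p)) :
    x * rexp (2 * π * |(k : ℝ)| * |s|) ≤ 16 * p ^ 2 * C * powTail 1 (p - 2) k := by
  have hk1 := one_le_abs_intCast hk0
  have hw := exp_weight_le hp hL hk1 hk hs
  have hpos : 0 < |(k : ℝ)| := by linarith
  calc x * rexp (2 * π * |(k : ℝ)| * |s|)
      ≤ (C * |(k : ℝ)| ^ (-p)) * (4 * p * |(k : ℝ)|) ^ 2 := by gcongr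
    _ = 16 * p ^ 2 * C * (|(k : ℝ)| ^ (-p) * |(k : ℝ)| ^ 2) := by ring
    _ = _ := by
      unfold powTail
      rw [if_pos hk1, ← Real.rpow_add_natCast hpos.ne']
      congr 2
      push_cast
      ring

/-- The entire function that approximates `g e^{iσΔ}`, where `g` has the coefficients `c` with
respect to the phase with derivative `∑ a_k e^{2πikt}`, and `Δ` is the difference of the
(truncated) phases. -/
def entireApprox (c a d : ℤ → ℂ) (N M : ℕ) (L κ : ℝ) (σ : ℤ) (z : ℂ) : ℂ :=
  (∑ j ∈ Finset.Icc (-(N : ℤ)) N, c j * cexp (2 * π * I * j * (trigPrim a N z / (2 * π * L)))) *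
    cexp (I * σ * (κ + trigPrim a N z - trigPrim d M z))

lemma differentiable_entireApprox (c a d : ℤ → ℂ) (N M : ℕ) (L κ : ℝ) (σ : ℤ) :
    Differentiable ℂ (entireApprox c a d N M L κ σ) := by
  have h1 := differentiable_trigPrim a N
  have h2 := differentiable_trigPrim d M
  unfold entireApprox
  fun_prop

/-- Over a period the first phase gains 2πL, so its normalization gains 1, and the difference of the
phases gains the multiple 2π(n - n') of 2π. -/
lemma entireApprox_add_one {c a d : ℤ → ℂ} {N M : ℕ} {L κ : ℝ} {σ : ℤ} {n n' : ℤ} (hL : L = n)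
    (hL0 : 0 < L) (ha : a 0 = 2 * π * n) (hd : d 0 = 2 * π * n') (z : ℂ) :
    entireApprox c a d N M L κ σ (z + 1) = entireApprox c a d N M L κ σ z := by
  have hLC : (L : ℂ) ≠ 0 := by exact_mod_cast hL0.ne'
  have hpi : (π : ℂ) ≠ 0 := by exact_mod_cast Real.pi_ne_zero
  have e1 : trigPrim a N (z + 1) / (2 * π * L) = trigPrim a N z / (2 * π * L) + 1 := by
    have hn : (n : ℂ) = L := by rw [hL]; simp
    rw [trigPrim_add_one, ha, hn]
    field_simp
  unfold entireApprox
  simp only [e1, cexp_add_one]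
  congr 1
  rw [trigPrim_add_one, trigPrim_add_one, ha, hd]
  have : I * σ * (κ + (trigPrim a N z + 2 * π * n) - (trigPrim d M z + 2 * π * n')) =
      I * σ * (κ + trigPrim a N z - trigPrim d M z) + (σ * (n - n') : ℤ) * (2 * π * I) := by
    push_cast; ring
  rw [this, Complex.exp_add, Complex.exp_int_mul_two_pi_mul_I, mul_one]

/-- The bound for the deviation of the truncated phase from the linear phase. -/
def constPhase (C p : ℝ) : ℝ := 64 * p ^ 2 * C

/-- The bound for the deviation of the approximate phase from the linear phase. -/
def constTrig (C₁ p : ℝ) (M : ℕ) : ℝ := 2 * M * (C₁ * (4 * p * M) ^ 2)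

/-- The bound for the approximating entire functions in the strip. -/
def constStrip (B C C₁ p R : ℝ) (M : ℕ) : ℝ :=
  (B + constPhase C p * rexp (constPhase C p)) *
    rexp (8 * π * p * R + constPhase C p + constTrig C₁ p M)

section Strip

variable {B C C₁ p L L' R : ℝ} {N M : ℕ} {a c d : ℤ → ℂ}

lemma norm_trigPrim_sub_le_constPhase (hC : 0 ≤ C) (hp : 4 ≤ p) (hL : rexp 1 ≤ L)
    (hN : 4 * p * N ≤ L) (ha0 : a 0 = 2 * π * L)
    (ha : ∀ k : ℤ, k ≠ 0 → ‖a k‖ ≤ C * |(k : ℝ)| ^ (-p)) {z : ℂ} (hz : |z.im| ≤ stripWidth p L) :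
    ‖trigPrim a N z - 2 * π * L * z‖ ≤ constPhase C p := by
  rw [← ha0]
  refine (norm_trigPrim_sub_le a N (b := fun k => 16 * p ^ 2 * C * powTail 1 (p - 2) k) z
    fun k hk hk0 => weighted_coeff_le hC hp hL hk0 ?_ hz (ha k hk0)).trans ?_
  · exact (mul_le_mul_of_nonneg_left (abs_le_of_mem_Icc hk) (by positivity)).trans hN
  · rw [← Finset.mul_sum]
    have := sum_powTail_le (N := 1) (s := p - 2) le_rfl (by linarith)
      ((Finset.Icc (-(N : ℤ)) N).erase 0)
    rw [Real.one_rpow] at this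
    calc _ ≤ 16 * p ^ 2 * C * (4 * 1) := by gcongr
      _ = _ := by unfold constPhase; ring

/-- No decay is available for the coefficients of an iterate; its frequencies are at most M instead,
so the weights are bounded by a constant depending on M. -/
lemma norm_coeff_mul_exp_le (hC₁ : 0 ≤ C₁) (hp : 4 ≤ p) (hL : rexp 1 ≤ L)
    (hM : 4 * p * M ≤ L) (hd : ∀ k : ℤ, k ≠ 0 → ‖d k‖ ≤ C₁) {z : ℂ}
    (hz : |z.im| ≤ stripWidth p L) {k : ℤ} (hk : k ∈ Finset.Icc (-(M : ℤ)) M) (hk0 : k ≠ 0) :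
    ‖d k‖ * rexp (2 * π * |(k : ℝ)| * |z.im|) ≤ C₁ * (4 * p * M) ^ 2 := by
  have h1 := abs_le_of_mem_Icc hk
  have h2 : 4 * p * |(k : ℝ)| ≤ 4 * p * M := by gcongr
  have h3 := exp_weight_le hp hL (one_le_abs_intCast hk0) (h2.trans hM) hz
  have := hd k hk0
  calc _ ≤ C₁ * (4 * p * |(k : ℝ)|) ^ 2 := by gcongr
    _ ≤ _ := by gcongr

lemma card_erase_zero (M : ℕ) : ((Finset.Icc (-(M : ℤ)) M).erase 0).card = 2 * M := by
  rw [Finset.card_erase_of_mem (zero_mem_Icc M), Int.card_Icc]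
  omega

lemma norm_trigPrim_sub_le_constTrig (hC₁ : 0 ≤ C₁) (hp : 4 ≤ p) (hL : rexp 1 ≤ L)
    (hM : 4 * p * M ≤ L) (hd0 : d 0 = 2 * π * L') (hd : ∀ k : ℤ, k ≠ 0 → ‖d k‖ ≤ C₁) {z : ℂ}
    (hz : |z.im| ≤ stripWidth p L) :
    ‖trigPrim d M z - 2 * π * L' * z‖ ≤ constTrig C₁ p M := by
  rw [← hd0]
  refine (norm_trigPrim_sub_le d M (b := fun _ => C₁ * (4 * p * M) ^ 2) z
    fun k hk hk0 => norm_coeff_mul_exp_le hC₁ hp hL hM hd hz hk hk0).trans ?_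
  rw [Finset.sum_const, card_erase_zero, nsmul_eq_mul]
  unfold constTrig
  push_cast
  exact le_rfl

lemma norm_trigPoly_sub_le_constTrig (hC₁ : 0 ≤ C₁) (hp : 4 ≤ p) (hL : rexp 1 ≤ L)
    (hM : 4 * p * M ≤ L) (hd0 : d 0 = 2 * π * L') (hd : ∀ k : ℤ, k ≠ 0 → ‖d k‖ ≤ C₁) {z : ℂ}
    (hz : |z.im| ≤ stripWidth p L) :
    ‖trigPoly d M z - 2 * π * L'‖ ≤ constTrig C₁ p M := by
  unfold trigPoly
  rw [← Finset.add_sum_erase _ _ (zero_mem_Icc M), hd0]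
  simp only [Int.cast_zero, mul_zero, zero_mul, Complex.exp_zero, mul_one, add_sub_cancel_left]
  refine (norm_sum_le_of_le _ (f := fun k : ℤ => d k * cexp (2 * π * I * k * z))
    (n := fun _ => C₁ * (4 * p * M) ^ 2) fun k hk => ?_).trans ?_
  · obtain ⟨hk0, hk⟩ := Finset.mem_erase.1 hk
    rw [norm_mul]
    exact (mul_le_mul_of_nonneg_left (norm_cexp_two_pi_mul_le k z) (norm_nonneg _)).trans
      (norm_coeff_mul_exp_le hC₁ hp hL hM hd hz hk hk0)
  · rw [Finset.sum_const, card_erase_zero, nsmul_eq_mul]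
    unfold constTrig
    push_cast
    exact le_rfl

/-- Both phases differ from linear ones by bounded amounts. The linear part of the first gives the
weights already absorbed by the coefficients; in the difference of the phases only L - L' survives,
which is bounded by R while the strip has bounded width. -/
lemma norm_entireApprox_le (hC : 0 ≤ C) (hC₁ : 0 ≤ C₁) (hp : 4 ≤ p) (hL : rexp 1 ≤ L)
    (hN : 4 * p * N ≤ L) (hM : 4 * p * M ≤ L) (hLL : |L - L'| ≤ R)
    (ha0 : a 0 = 2 * π * L) (ha : ∀ k : ℤ, k ≠ 0 → ‖a k‖ ≤ C * |(k : ℝ)| ^ (-p))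
    (hd0 : d 0 = 2 * π * L') (hd : ∀ k : ℤ, k ≠ 0 → ‖d k‖ ≤ C₁)
    (hc0 : ‖c 0‖ ≤ B) (hc : ∀ k : ℤ, k ≠ 0 → ‖c k‖ ≤ C * |(k : ℝ)| ^ (-p)) (κ : ℝ) {σ : ℤ}
    (hσ : |σ| ≤ 1) {z : ℂ} (hz : |z.im| ≤ stripWidth p L) :
    ‖entireApprox c a d N M L κ σ z‖ ≤ constStrip B C C₁ p R M := by
  have hL0 : 0 < L := (Real.exp_pos 1).trans_le hL
  have hLC : (L : ℂ) ≠ 0 := by exact_mod_cast hL0.ne'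
  have hpi : (π : ℂ) ≠ 0 := by exact_mod_cast Real.pi_ne_zero
  have h1 := norm_trigPrim_sub_le_constPhase hC hp hL hN ha0 ha hz
  have h2 := norm_trigPrim_sub_le_constTrig hC₁ hp hL hM hd0 hd hz
  set A := constPhase C p with hA
  set T := constTrig C₁ p M
  have hA0 : 0 ≤ A := (norm_nonneg _).trans h1
  unfold entireApprox constStrip
  rw [norm_mul]
  refine mul_le_mul ?_ ?_ (norm_nonneg _) ?_
  · rw [← Finset.add_sum_erase _ _ (zero_mem_Icc N)]
    refine (norm_add_le _ _).trans (add_le_add (by simpa using hc0) ?_)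
    refine (norm_sum_le_of_le _ (n := fun k => 16 * p ^ 2 * C * powTail 1 (p - 2) k * rexp A)
      fun k hk => ?_).trans ?_
    · obtain ⟨hk0, hk⟩ := Finset.mem_erase.1 hk
      have hk4 : 4 * p * |(k : ℝ)| ≤ L :=
        (mul_le_mul_of_nonneg_left (abs_le_of_mem_Icc hk) (by positivity)).trans hN
      have hkL : |(k : ℝ)| ≤ L := by nlinarith [abs_nonneg (k : ℝ)]
      -- The deviation A from the linear phase is multiplied by k/L, hence contributes at most e^A
      -- because |k| ≤ L.
      have e : (2 * π * I * k * (trigPrim a N z / (2 * π * L)) : ℂ) = 2 * π * I * k * z +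
          I * k * ((trigPrim a N z - 2 * π * L * z) / L) := by
        field_simp
        ring
      have h3 : ‖cexp (I * k * ((trigPrim a N z - 2 * π * L * z) / L))‖ ≤ rexp A := by
        refine (Complex.norm_exp_le_exp_norm _).trans (Real.exp_le_exp.2 ?_)
        rw [norm_mul, norm_mul, norm_I, one_mul, Complex.norm_intCast, norm_div, Complex.norm_real,
          Real.norm_eq_abs, abs_of_pos hL0, mul_div_assoc', div_le_iff₀ hL0, mul_comm A L]
        gcongr
      rw [e, Complex.exp_add, norm_mul, norm_mul, ← mul_assoc]
      have h4 := weighted_coeff_le hC hp hL hk0 hk4 hz (hc k hk0)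
      have h5 := norm_cexp_two_pi_mul_le k z
      refine mul_le_mul (le_trans ?_ h4) h3 (norm_nonneg _) (le_trans (by positivity) h4)
      gcongr
    · rw [← Finset.sum_mul, ← Finset.mul_sum]
      have := sum_powTail_le (N := 1) (s := p - 2) le_rfl (by linarith)
        ((Finset.Icc (-(N : ℤ)) N).erase 0)
      rw [Real.one_rpow] at this
      calc _ ≤ 16 * p ^ 2 * C * (4 * 1) * rexp A := by gcongr
        _ = _ := by rw [hA]; unfold constPhase; ring
  · have e : I * σ * (κ + trigPrim a N z - trigPrim d M z) =
        ((σ * κ : ℝ) : ℂ) * I + ((2 * π * σ * (L - L') : ℝ) : ℂ) * z * I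
          + I * σ * ((trigPrim a N z - 2 * π * L * z) - (trigPrim d M z - 2 * π * L' * z)) := by
      push_cast; ring
    rw [e, Complex.exp_add, Complex.exp_add, norm_mul, norm_mul, Complex.norm_exp_ofReal_mul_I,
      one_mul, add_assoc, Real.exp_add]
    have hσ' : ‖(σ : ℂ)‖ ≤ 1 := by rw [Complex.norm_intCast]; exact_mod_cast hσ
    have hσ'' : |(σ : ℝ)| ≤ 1 := by exact_mod_cast hσ
    refine mul_le_mul ?_ ?_ (norm_nonneg _) (Real.exp_pos _).le
    · rw [Complex.norm_exp]
      apply Real.exp_le_exp.2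
      have hy := stripWidth_le hp hL
      have hre : (((2 * π * σ * (L - L') : ℝ) : ℂ) * z * I).re =
          -(2 * π * σ * (L - L') * z.im) := by
        simp [mul_re, mul_im]
      rw [hre]
      calc -(2 * π * σ * (L - L') * z.im) ≤ |-(2 * π * σ * (L - L') * z.im)| := le_abs_self _
        _ = 2 * π * |(σ : ℝ)| * |L - L'| * |z.im| := by
          rw [abs_neg, abs_mul, abs_mul, abs_mul, abs_of_pos (by positivity : 0 < 2 * π)]
        _ ≤ 2 * π * 1 * R * (4 * p) := by
          have hR : 0 ≤ R := (abs_nonneg _).trans hLL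
          gcongr
          exact hz.trans hy
        _ = _ := by ring
    · refine (Complex.norm_exp_le_exp_norm _).trans (Real.exp_le_exp.2 ?_)
      rw [norm_mul, norm_mul, norm_I, one_mul]
      have h3 := (norm_sub_le (trigPrim a N z - 2 * π * L * z)
        (trigPrim d M z - 2 * π * L' * z)).trans (add_le_add h1 h2)
      calc _ ≤ 1 * (A + T) := by gcongr
        _ = _ := one_mul _
  · have := (norm_nonneg _).trans hc0
    positivity

/-- Exponential smallness, expressed as a power, of the high frequencies of `entireApprox`. -/
lemma norm_circCoeff_entireApprox_le (hC : 0 ≤ C) (hC₁ : 0 ≤ C₁) (hp : 4 ≤ p) (hL : rexp 1 ≤ L)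
    (hN : 4 * p * N ≤ L) (hM : 4 * p * M ≤ L) (hLL : |L - L'| ≤ R) (hL' : L ≤ 2 * L')
    (hT : constTrig C₁ p M ≤ 2 * p * Real.log L) (hT' : constTrig C₁ p M ≤ 2 * π * L')
    {n n' : ℤ} (hn : L = n) (hn' : L' = n')
    (ha0 : a 0 = 2 * π * L) (ha : ∀ k : ℤ, k ≠ 0 → ‖a k‖ ≤ C * |(k : ℝ)| ^ (-p))
    (hd0 : d 0 = 2 * π * L') (hd : ∀ k : ℤ, k ≠ 0 → ‖d k‖ ≤ C₁)
    (hc0 : ‖c 0‖ ≤ B) (hc : ∀ k : ℤ, k ≠ 0 → ‖c k‖ ≤ C * |(k : ℝ)| ^ (-p)) (κ : ℝ) {σ : ℤ}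
    (hσ : |σ| ≤ 1) {q : ℝ → ℝ} (hq : ∀ t : ℝ, (q t : ℂ) = trigPrim d M t / (2 * π * L'))
    (hq' : ∀ t : ℝ, ((deriv q t : ℝ) : ℂ) = trigPoly d M t / (2 * π * L'))
    {k : ℤ} (hk : L ≤ 4 * |(k : ℝ)|) :
    ‖circCoeff q (fun t => entireApprox c a d N M L κ σ t) k‖ ≤
      2 * constStrip B C C₁ p R M * |(k : ℝ)| ^ (-p) := by
  have hL0 : 0 < L := (Real.exp_pos 1).trans_le hL
  have hL'0 : 0 < L' := by linarith
  have hLC : (L' : ℂ) ≠ 0 := by exact_mod_cast hL'0.ne'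
  have hpi : (π : ℂ) ≠ 0 := by exact_mod_cast Real.pi_ne_zero
  have hk0 : 0 < |(k : ℝ)| := by linarith
  have hy0 := stripWidth_nonneg hp hL
  set y := stripWidth p L with hy
  set H : ℂ → ℂ := fun z => entireApprox c a d N M L κ σ z *
    cexp (-(2 * π * I * k * (trigPrim d M z / (2 * π * L')))) * (trigPoly d M z / (2 * π * L'))
    with hH
  have hHd : Differentiable ℂ H := by
    have h1 := differentiable_entireApprox c a d N M L κ σ
    have h2 := differentiable_trigPrim d M
    have h3 := differentiable_trigPoly d M
    fun_prop
  have hH1 : ∀ z, H (z + 1) = H z := fun z => by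
    have e1 : trigPrim d M (z + 1) / (2 * π * L') = trigPrim d M z / (2 * π * L') + 1 := by
      rw [trigPrim_add_one, hd0]
      field_simp
    have e2 : entireApprox c a d N M L κ σ (z + 1) = entireApprox c a d N M L κ σ z :=
      entireApprox_add_one (n' := n') hn hL0 (by rw [ha0, hn]; simp) (by rw [hd0, hn']; simp) z
    simp only [hH]
    rw [e1, e2, trigPoly_add_one, Complex.exp_neg, Complex.exp_neg, cexp_add_one]
  -- The contour moves to the side on which e^{-2πikz} decays, so the sign of s is opposite to that
  -- of k.
  obtain ⟨s, hs1, hs2⟩ : ∃ s : ℝ, |s| = y ∧ k * s = -(|(k : ℝ)| * y) := by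
    rcases le_total 0 (k : ℝ) with h | h
    · exact ⟨-y, by rw [abs_neg, abs_of_nonneg hy0], by rw [abs_of_nonneg h]; ring⟩
    · exact ⟨y, abs_of_nonneg hy0, by rw [abs_of_nonpos h]; ring⟩
  have hcirc : circCoeff q (fun t => entireApprox c a d N M L κ σ t) k =
      ∫ t in (0 : ℝ)..1, H (t + s * I) := by
    rw [← integral_eq_integral_add_mul_I hHd hH1]
    unfold circCoeff
    simp only [hH, hq, hq']
  rw [hcirc]
  have hbound : ∀ t ∈ uIoc (0 : ℝ) 1, ‖H (t + s * I)‖ ≤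
      2 * constStrip B C C₁ p R M * |(k : ℝ)| ^ (-p) := by
    intro t _
    set z : ℂ := t + s * I with hz
    have him : z.im = s := by simp [hz]
    have hzy : |z.im| ≤ stripWidth p L := by rw [him, hs1]
    have b1 := norm_entireApprox_le hC hC₁ hp hL hN hM hLL ha0 ha hd0 hd hc0 hc κ hσ hzy
    have b2 := norm_trigPrim_sub_le_constTrig hC₁ hp hL hM hd0 hd hzy
    have b3 := norm_trigPoly_sub_le_constTrig hC₁ hp hL hM hd0 hd hzy
    have nL' : ‖(2 * π * L' : ℂ)‖ = 2 * π * L' := by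
      rw [show (2 * π * L' : ℂ) = ((2 * π * L' : ℝ) : ℂ) by push_cast; ring, Complex.norm_real,
        Real.norm_eq_abs, abs_of_pos (by positivity)]
    have b4 : ‖trigPoly d M z / (2 * π * L')‖ ≤ 2 := by
      rw [norm_div, nL', div_le_iff₀ (by positivity)]
      have := norm_le_norm_sub_add (trigPoly d M z) (2 * π * L')
      rw [nL'] at this
      linarith
    -- The shift gains e^{-8p|k| log L / L}. The deviation from the linear phase, at most 2p log L
    -- and divided by L' ≥ L/2, gives back at most half of the exponent; what remains is below
    -- |k|^{-p}.
    have b5 : ‖cexp (-(2 * π * I * k * (trigPrim d M z / (2 * π * L'))))‖ ≤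
        |(k : ℝ)| ^ (-p) := by
      have e : -(2 * π * I * k * (trigPrim d M z / (2 * π * L'))) = 2 * π * I * (-k : ℤ) * z +
          I * (-k : ℤ) * ((trigPrim d M z - 2 * π * L' * z) / L') := by
        push_cast
        field_simp
        ring
      rw [e, Complex.exp_add, norm_mul, norm_cexp_two_pi_mul, him]
      have h3 : ‖cexp (I * (-k : ℤ) * ((trigPrim d M z - 2 * π * L' * z) / L'))‖ ≤
          rexp (4 * p * |(k : ℝ)| * Real.log L / L) := by
        refine (Complex.norm_exp_le_exp_norm _).trans (Real.exp_le_exp.2 ?_)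
        rw [norm_mul, norm_mul, norm_I, one_mul, Complex.norm_intCast, norm_div, Complex.norm_real,
          Real.norm_eq_abs, abs_of_pos hL'0, Int.cast_neg, abs_neg]
        calc |(k : ℝ)| * (‖trigPrim d M z - 2 * π * L' * z‖ / L')
            ≤ |(k : ℝ)| * (2 * p * Real.log L / (L / 2)) := by
              have : 0 ≤ 2 * p * Real.log L := ((norm_nonneg _).trans b2).trans hT
              gcongr
              · exact b2.trans hT
              · linarith
          _ = _ := by field_simp; ring
      have h4 : rexp (-(2 * π * (-k : ℤ) * s)) =
          rexp (-(4 * p * |(k : ℝ)| * Real.log L / L)) *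
            rexp (-(4 * p * |(k : ℝ)| * Real.log L / L)) := by
        rw [← Real.exp_add]
        congr 1
        have : -(2 * π * ((-k : ℤ) : ℝ) * s) = 2 * π * (k * s) := by push_cast; ring
        rw [this, hs2, hy]
        unfold stripWidth
        have := Real.pi_ne_zero
        field_simp
        ring
      have h5 := exp_neg_mul_le_of_le hL hk (by linarith : 0 ≤ p)
      rw [h4]
      calc _ ≤ rexp (-(4 * p * |(k : ℝ)| * Real.log L / L)) *
            rexp (-(4 * p * |(k : ℝ)| * Real.log L / L)) *
            rexp (4 * p * |(k : ℝ)| * Real.log L / L) := by gcongr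
        _ = rexp (-(4 * p * |(k : ℝ)| * Real.log L / L)) := by
          rw [mul_assoc, ← Real.exp_add, neg_add_cancel, Real.exp_zero, mul_one]
        _ ≤ _ := h5
    simp only [hH]
    rw [norm_mul, norm_mul]
    have h0 := (norm_nonneg _).trans b1
    calc _ ≤ constStrip B C C₁ p R M * |(k : ℝ)| ^ (-p) * 2 := by gcongr
      _ = _ := by ring
  simpa using intervalIntegral.norm_integral_le_of_norm_le_const hbound

end Strip

/-! ### Phase functions and their coefficients. -/

lemma isCircleDiffeo_id : IsCircleDiffeo (fun t => t) where
  contDiff := contDiff_id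
  map_zero := rfl
  map_add_one _ := rfl
  le_deriv t := by norm_num
  deriv_le t := by norm_num

lemma coeff_eq_integral (g : ℝ → ℝ) (k : ℤ) :
    coeff g k = ∫ t in (0 : ℝ)..1, (g t : ℂ) * cexp (-(2 * π * I * k * t)) := by
  unfold coeff
  rw [fourierCoeffOn_eq_integral]
  simp only [sub_zero, div_one, one_smul]
  congr 1; ext t
  rw [fourier_coe_apply, smul_eq_mul, mul_comm]
  congr 2
  push_cast
  ring

lemma coeff_eq_circCoeff (g : ℝ → ℝ) (k : ℤ) :
    coeff g k = circCoeff (fun t => t) (fun t => (g t : ℂ)) k := by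
  rw [coeff_eq_integral]
  unfold circCoeff
  simp

lemma deriv_normPhase (φ : ℝ → ℝ) (t : ℝ) :
    deriv (normPhase φ) t = deriv φ t / (2 * π * numPeriods φ) := by
  unfold normPhase
  rw [deriv_div_const, deriv_sub_const]

lemma phaseFourier_intCast (φ g : ℝ → ℝ) (k : ℤ) :
    phaseFourier φ g k = circCoeff (normPhase φ) (fun t => (g t : ℂ)) k := by
  unfold phaseFourier circCoeff
  simp only [Complex.ofReal_intCast]

lemma periodic_deriv_of_map_add_one {φ : ℝ → ℝ} {c : ℝ} (h : ∀ t, φ (t + 1) = φ t + c) :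
    Function.Periodic (deriv φ) 1 := fun t => by
  rw [← deriv_comp_add_const, funext h, deriv_add_const]

namespace IsPhase

variable {φ : ℝ → ℝ}

lemma continuous (hφ : IsPhase φ) : Continuous φ := hφ.contDiff.continuous

lemma continuous_deriv (hφ : IsPhase φ) : Continuous (deriv φ) :=
  hφ.contDiff.continuous_deriv le_rfl

lemma hasDerivAt (hφ : IsPhase φ) (t : ℝ) : HasDerivAt φ (deriv φ t) t :=
  (hφ.contDiff.differentiable one_ne_zero t).hasDerivAt

lemma exists_numPeriods_eq (hφ : IsPhase φ) :
    ∃ n : ℤ, numPeriods φ = n ∧ ∀ t, φ (t + 1) = φ t + 2 * π * n := by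
  obtain ⟨n, hn⟩ := hφ.quasiPeriodic
  refine ⟨n, ?_, hn⟩
  have := hn 0
  rw [zero_add] at this
  unfold numPeriods
  have := Real.pi_ne_zero
  rw [div_eq_iff (by positivity)]
  linarith

lemma map_add_one (hφ : IsPhase φ) (t : ℝ) : φ (t + 1) = φ t + 2 * π * numPeriods φ := by
  obtain ⟨n, h1, h2⟩ := hφ.exists_numPeriods_eq
  rw [h1, h2]

lemma periodic_deriv (hφ : IsPhase φ) : Function.Periodic (deriv φ) 1 :=
  periodic_deriv_of_map_add_one hφ.map_add_one

lemma coeff_deriv_zero (hφ : IsPhase φ) : coeff (deriv φ) 0 = 2 * π * numPeriods φ := by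
  rw [coeff_eq_integral]
  simp only [Int.cast_zero, mul_zero, zero_mul, neg_zero, Complex.exp_zero, mul_one]
  rw [intervalIntegral.integral_ofReal, intervalIntegral.integral_deriv_eq_sub
    (fun t _ => (hφ.hasDerivAt t).differentiableAt) (hφ.continuous_deriv.intervalIntegrable _ _)]
  have := hφ.map_add_one 0
  rw [zero_add] at this
  rw [this]
  push_cast
  ring

lemma isCircleDiffeo_normPhase (hφ : IsPhase φ) (hL : 0 < numPeriods φ)
    (h : ∀ t, |deriv φ t - 2 * π * numPeriods φ| ≤ π * numPeriods φ) :
    IsCircleDiffeo (normPhase φ) := by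
  have hpos : 0 < 2 * π * numPeriods φ := by have := Real.pi_pos; positivity
  refine ⟨?_, by simp [normPhase], fun t => ?_, fun t => ?_, fun t => ?_⟩
  · have := hφ.contDiff
    unfold normPhase
    fun_prop
  · unfold normPhase
    rw [hφ.map_add_one]
    field_simp
    ring
  · rw [deriv_normPhase, le_div_iff₀ hpos]
    linarith [(abs_le.1 (h t)).1]
  · rw [deriv_normPhase, div_le_iff₀ hpos]
    have : 0 < π * numPeriods φ := by have := Real.pi_pos; positivity
    linarith [(abs_le.1 (h t)).2]

end IsPhase

/-! ### Replacing the true functions by entire ones. -/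

lemma norm_cexp_ofReal_freq (k : ℤ) (x : ℝ) : ‖cexp (2 * π * I * k * x)‖ = 1 := by
  rw [norm_cexp_two_pi_mul]
  simp

lemma norm_cexp_sub_one_le {w : ℂ} {D : ℝ} (hD : D ≤ 1) (hw : ‖w‖ ≤ D) :
    ‖cexp w - 1‖ ≤ 2 * D :=
  (Complex.norm_exp_sub_one_le (hw.trans hD)).trans (by linarith)

lemma lt_abs_of_notMem_Icc {N : ℕ} {k : ℤ} (hk : k ∉ Finset.Icc (-(N : ℤ)) N) :
    (N : ℝ) + 1 ≤ |(k : ℝ)| := by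
  rw [Finset.mem_Icc, ← abs_le] at hk
  exact_mod_cast not_le.1 hk

/-- Truncation of a Fourier series with power decay. -/
lemma IsCircleDiffeo.norm_sub_trunc_le {q : ℝ → ℝ} (hq : IsCircleDiffeo q) {g : ℝ → ℂ}
    (hg : Continuous g) (hper : Function.Periodic g 1) {C p X : ℝ} (hC : 0 ≤ C) (hp : 2 ≤ p)
    (hX : 1 ≤ X) {S : Finset ℤ} (hS : ∀ k ∉ S, X ≤ |(k : ℝ)|)
    (hc : ∀ k ∉ S, ‖circCoeff q g k‖ ≤ C * |(k : ℝ)| ^ (-p)) (t : ℝ) :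
    ‖g t - ∑ k ∈ S, circCoeff q g k * cexp (2 * π * I * k * q t)‖ ≤ 4 * C * X ^ (1 - p) := by
  obtain ⟨h1, h2⟩ := summable_powTail hX hp
  refine (hq.norm_sub_sum_le hg hper (b := fun k => C * powTail X p k) (h1.mul_left C)
    (fun k hk => ?_) (fun k => mul_nonneg hC (powTail_nonneg _ _ _)) t).trans ?_
  · unfold powTail
    rw [if_pos (hS k hk)]
    exact hc k hk
  · rw [tsum_mul_left]
    nlinarith

lemma abs_deriv_sub_le {θ : ℝ → ℝ} (hθ : IsPhase θ) {C p : ℝ} (hC : 0 ≤ C) (hp : 2 ≤ p)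
    (ha : ∀ k : ℤ, k ≠ 0 → ‖coeff (deriv θ) k‖ ≤ C * |(k : ℝ)| ^ (-p)) (t : ℝ) :
    |deriv θ t - 2 * π * numPeriods θ| ≤ 4 * C := by
  have h := isCircleDiffeo_id.norm_sub_trunc_le (g := fun t => ((deriv θ t : ℝ) : ℂ))
    (X := 1) (S := {0}) (Complex.continuous_ofReal.comp hθ.continuous_deriv)
    (fun t => by simp only [hθ.periodic_deriv t]) hC hp le_rfl
    (fun k hk => one_le_abs_intCast (by simpa using hk))
    (fun k hk => by rw [← coeff_eq_circCoeff]; exact ha k (by simpa using hk)) t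
  rw [Finset.sum_singleton, ← coeff_eq_circCoeff, hθ.coeff_deriv_zero, Real.one_rpow] at h
  simp only [Int.cast_zero, mul_zero, zero_mul, Complex.exp_zero, mul_one] at h
  rw [← Real.norm_eq_abs, ← Complex.norm_real]
  push_cast
  exact h

/-- The difference vanishes at 0 and its derivative is the truncation error of θ', so the mean value
inequality on the unit interval applies. -/
lemma norm_phase_sub_trigPrim_le {θ : ℝ → ℝ} (hθ : IsPhase θ) {C p X : ℝ} (hC : 0 ≤ C)
    (hp : 2 ≤ p) (hX : 1 ≤ X) {N : ℕ} (hN : X ≤ N + 1)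
    (ha : ∀ k : ℤ, k ≠ 0 → ‖coeff (deriv θ) k‖ ≤ C * |(k : ℝ)| ^ (-p)) {t : ℝ}
    (ht : t ∈ Icc (0 : ℝ) 1) :
    ‖((θ t - θ 0 : ℝ) : ℂ) - trigPrim (coeff (deriv θ)) N t‖ ≤ 4 * C * X ^ (1 - p) := by
  have hd : ∀ t : ℝ, HasDerivAt (fun t : ℝ => ((θ t - θ 0 : ℝ) : ℂ) -
      trigPrim (coeff (deriv θ)) N t)
      (((deriv θ t : ℝ) : ℂ) - trigPoly (coeff (deriv θ)) N t) t := fun t =>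
    ((hθ.hasDerivAt t).sub_const (θ 0)).ofReal_comp.sub
      (hasDerivAt_trigPrim (coeff (deriv θ)) N t).comp_ofReal
  have h := norm_image_sub_le_of_norm_deriv_le_segment' (C := 4 * C * X ^ (1 - p))
    (fun t (_ : t ∈ Icc (0 : ℝ) 1) => (hd t).hasDerivWithinAt) (fun t _ => by
      have := isCircleDiffeo_id.norm_sub_trunc_le (g := fun t => ((deriv θ t : ℝ) : ℂ))
        (X := X) (S := Finset.Icc (-(N : ℤ)) N)
        (Complex.continuous_ofReal.comp hθ.continuous_deriv)
        (fun t => by simp only [hθ.periodic_deriv t]) hC hp hX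
        (fun k hk => hN.trans (lt_abs_of_notMem_Icc hk))
        (fun k hk => by
          rw [← coeff_eq_circCoeff]
          exact ha k (fun h => hk (h ▸ zero_mem_Icc N))) t
      simpa only [← coeff_eq_circCoeff, trigPoly] using this) t ht
  simp only [sub_self, Complex.ofReal_zero, trigPrim_zero, sub_zero] at h
  refine h.trans ?_
  have : 0 ≤ 4 * C * X ^ (1 - p) := by positivity
  nlinarith [ht.2]

/-- Three errors of size D occur: truncating the series of g, truncating the phase inside its
exponentials, and truncating θ in the factor e^{iσ(θ-ψ)}. The second is harmless because the phase
error at frequency j carries the factor j/L ≤ 1. -/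
lemma norm_mul_cexp_sub_entireApprox_le {θ ψ : ℝ → ℝ} (hθ : IsPhase θ)
    (hqθ : IsCircleDiffeo (normPhase θ)) {g : ℝ → ℂ} (hg : Continuous g)
    (hper : Function.Periodic g 1) {B C p X : ℝ} (hB : 0 ≤ B) (hC : 0 ≤ C) (hp : 4 ≤ p)
    (hX : 1 ≤ X) (hX1 : 4 * C * X ^ (1 - p) ≤ 1) {N M : ℕ} (hN : X ≤ N + 1)
    (hNL : N ≤ numPeriods θ) (hL : 0 < numPeriods θ)
    (ha : ∀ k : ℤ, k ≠ 0 → ‖coeff (deriv θ) k‖ ≤ C * |(k : ℝ)| ^ (-p))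
    (hc0 : ‖circCoeff (normPhase θ) g 0‖ ≤ B)
    (hc : ∀ k : ℤ, k ≠ 0 → ‖circCoeff (normPhase θ) g k‖ ≤ C * |(k : ℝ)| ^ (-p))
    {d : ℤ → ℂ} (hd : ∀ t : ℝ, (ψ t : ℂ) = trigPrim d M t) {σ : ℤ} (hσ : |σ| ≤ 1) {t : ℝ}
    (ht : t ∈ Icc (0 : ℝ) 1) :
    ‖g t * cexp (I * σ * ((θ t - ψ t : ℝ) : ℂ)) - entireApprox (circCoeff (normPhase θ) g)
      (coeff (deriv θ)) d N M (numPeriods θ) (θ 0) σ t‖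
      ≤ (3 + 32 * C + 2 * B) * (4 * C * X ^ (1 - p)) := by
  set D := 4 * C * X ^ (1 - p) with hD
  set q := normPhase θ with hq
  set c := circCoeff q g with hcdef
  set L := numPeriods θ with hLdef
  set P := trigPrim (coeff (deriv θ)) N t with hP
  have hpi : (π : ℂ) ≠ 0 := by exact_mod_cast Real.pi_ne_zero
  have hLC : (L : ℂ) ≠ 0 := by exact_mod_cast hL.ne'
  have hD0 : 0 ≤ D := by positivity
  have hδ : ‖((θ t - θ 0 : ℝ) : ℂ) - P‖ ≤ D :=
    norm_phase_sub_trigPrim_le hθ hC (by linarith) hX hN ha ht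
  obtain ⟨δ, hδdef⟩ : ∃ δ : ℂ, δ = ((θ t - θ 0 : ℝ) : ℂ) - P := ⟨_, rfl⟩
  rw [← hδdef] at hδ
  have hPδ : P = ((θ t - θ 0 : ℝ) : ℂ) - δ := by rw [hδdef]; ring
  have hqt : (q t : ℂ) = ((θ t - θ 0 : ℝ) : ℂ) / (2 * π * L) := by
    rw [hq]; unfold normPhase; push_cast; rfl
  have h1 : ‖g t - ∑ j ∈ Finset.Icc (-(N : ℤ)) N, c j * cexp (2 * π * I * j * q t)‖ ≤ D :=
    hqθ.norm_sub_trunc_le hg hper hC (by linarith) hX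
      (fun k hk => hN.trans (lt_abs_of_notMem_Icc hk))
      (fun k hk => hc k (fun h => hk (h ▸ zero_mem_Icc N))) t
  have h2 : ‖g t‖ ≤ B + 4 * C := by
    have := hqθ.norm_sub_trunc_le hg hper hC (by linarith : 2 ≤ p) le_rfl (S := {0})
      (fun k hk => one_le_abs_intCast (by simpa using hk))
      (fun k hk => hc k (by simpa using hk)) t
    rw [Finset.sum_singleton, Real.one_rpow] at this
    simp only [Int.cast_zero, mul_zero, zero_mul, Complex.exp_zero, mul_one] at this
    have h3 := norm_le_norm_sub_add (g t) (circCoeff q g 0)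
    linarith
  have h3 : ‖∑ j ∈ Finset.Icc (-(N : ℤ)) N, c j * cexp (2 * π * I * j * q t) -
      ∑ j ∈ Finset.Icc (-(N : ℤ)) N, c j * cexp (2 * π * I * j * (P / (2 * π * L)))‖
      ≤ 8 * C * D := by
    rw [← Finset.sum_sub_distrib]
    calc _ ≤ ∑ j ∈ Finset.Icc (-(N : ℤ)) N, C * powTail 1 p j * (2 * D) := by
          refine norm_sum_le_of_le _ fun j hj => ?_
          by_cases hj0 : j = 0
          · subst hj0
            simp only [Int.cast_zero, mul_zero, zero_mul, Complex.exp_zero, sub_self, norm_zero]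
            have := powTail_nonneg 1 p 0
            positivity
          · have e : (2 * π * I * j * (P / (2 * π * L)) : ℂ) = 2 * π * I * j * q t +
                -(I * j * δ / L) := by
              rw [hPδ, hqt]; field_simp; ring
            rw [e, Complex.exp_add, ← mul_sub, norm_mul, ← mul_one_sub, norm_mul,
              norm_cexp_ofReal_freq, one_mul, norm_sub_rev]
            have h4 : ‖-(I * j * δ / L)‖ ≤ D := by
              rw [norm_neg, norm_div, norm_mul, norm_mul, norm_I, one_mul, Complex.norm_intCast,
                Complex.norm_real, Real.norm_eq_abs, abs_of_pos hL, div_le_iff₀ hL, mul_comm D]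
              have := (abs_le_of_mem_Icc hj).trans hNL
              gcongr
            unfold powTail
            rw [if_pos (one_le_abs_intCast hj0)]
            have := hc j hj0
            have h5 := norm_cexp_sub_one_le hX1 h4
            gcongr
      _ ≤ C * (4 * 1) * (2 * D) := by
          rw [← Finset.sum_mul, ← Finset.mul_sum]
          have := sum_powTail_le (N := 1) (s := p) le_rfl (by linarith)
            (Finset.Icc (-(N : ℤ)) N)
          rw [Real.one_rpow] at this
          gcongr
      _ = _ := by ring
  have e : I * σ * ((θ 0 : ℂ) + P - trigPrim d M t) =
      I * σ * ((θ t - ψ t : ℝ) : ℂ) + -(I * σ * δ) := by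
    rw [hPδ, ← hd]; push_cast; ring
  have hσ' : ‖(σ : ℂ)‖ ≤ 1 := by rw [Complex.norm_intCast]; exact_mod_cast hσ
  have h4 : ‖cexp (-(I * σ * δ)) - 1‖ ≤ 2 * D := by
    refine norm_cexp_sub_one_le hX1 ?_
    rw [norm_neg, norm_mul, norm_mul, norm_I, one_mul]
    calc _ ≤ 1 * D := by gcongr
      _ = D := one_mul D
  have h5 : ‖cexp (-(I * σ * δ))‖ ≤ 3 := by
    have := norm_le_norm_sub_add (cexp (-(I * σ * δ))) 1
    rw [norm_one] at this
    linarith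
  have h6 : ‖cexp (I * σ * ((θ t - ψ t : ℝ) : ℂ))‖ = 1 := by
    rw [show I * σ * ((θ t - ψ t : ℝ) : ℂ) = ((σ * (θ t - ψ t) : ℝ) : ℂ) * I by push_cast; ring]
    exact Complex.norm_exp_ofReal_mul_I _
  unfold entireApprox
  rw [← hP, e, Complex.exp_add]
  set E := cexp (I * σ * ((θ t - ψ t : ℝ) : ℂ))
  set F := cexp (-(I * σ * δ))
  set S1 := ∑ j ∈ Finset.Icc (-(N : ℤ)) N, c j * cexp (2 * π * I * j * q t)
  set S2 := ∑ j ∈ Finset.Icc (-(N : ℤ)) N, c j * cexp (2 * π * I * j * (P / (2 * π * L)))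
  have e2 : g t * E - S2 * (E * F) = ((g t - S1) + (S1 - S2)) * (E * F) + g t * (E * -(F - 1)) := by
    ring
  rw [e2]
  refine (norm_add_le _ _).trans ?_
  rw [norm_mul, norm_mul, norm_mul, norm_mul, norm_neg, h6, one_mul, one_mul]
  have h7 := (norm_add_le (g t - S1) (S1 - S2)).trans (add_le_add h1 h3)
  calc _ ≤ (D + 8 * C * D) * 3 + (B + 4 * C) * (2 * D) := by gcongr
    _ = _ := by ring

/-! ### The computed envelope as a low-pass sum. -/

lemma IsCircleDiffeo.circCoeff_const {q : ℝ → ℝ} (hq : IsCircleDiffeo q) (c : ℂ) (k : ℤ) :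
    circCoeff q (fun _ => c) k = if k = 0 then c else 0 := by
  obtain ⟨r, hr, -, hrq, -⟩ := hq.exists_inverse
  rw [hq.circCoeff_eq_integral hr hrq continuous_const, intervalIntegral.integral_const_mul]
  split_ifs with h
  · subst h
    simp
  · have e : ∀ x : ℝ, cexp (-(2 * π * I * k * x)) = cexp (-(2 * π * I * k) * x) := fun x => by
      ring_nf
    simp only [e]
    rw [integral_exp_mul_complex (neg_ne_zero.2 (two_pi_I_mul_ne_zero h))]
    have : cexp (-(2 * π * I * k) * (1 : ℝ)) = 1 := by
      rw [show (-(2 * π * I * k) * (1 : ℝ) : ℂ) = ((-k : ℤ) : ℂ) * (2 * π * I) by push_cast; ring]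
      exact Complex.exp_int_mul_two_pi_mul_I _
    rw [this]
    simp

lemma conj_circCoeff (q g : ℝ → ℝ) (k : ℤ) :
    (starRingEnd ℂ) (circCoeff q (fun t => (g t : ℂ)) k) =
      circCoeff q (fun t => (g t : ℂ)) (-k) := by
  unfold circCoeff
  rw [← intervalIntegral.intervalIntegral_conj]
  congr 1; ext t
  simp only [map_mul, Complex.conj_ofReal, ← Complex.exp_conj, map_neg, Complex.conj_I, map_ofNat,
    map_intCast]
  push_cast
  ring_nf

/-- The frequencies selected by the cutoff, `|k| < n/2`. -/
def lowFreq (n : ℤ) : Finset ℤ := (Finset.Icc (-n) n).filter fun k => 2 * |k| < n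

lemma mem_lowFreq {n k : ℤ} : k ∈ lowFreq n ↔ 2 * |k| < n := by
  unfold lowFreq
  rw [Finset.mem_filter, Finset.mem_Icc, ← abs_le]
  constructor
  · exact fun h => h.2
  · intro h
    have := abs_nonneg k
    exact ⟨by omega, h⟩

lemma card_lowFreq_le {n : ℤ} (hn : 0 < n) : ((lowFreq n).card : ℝ) ≤ 3 * n := by
  have h1 : ((lowFreq n).card : ℤ) ≤ 3 * n := by
    have : (lowFreq n).card ≤ (Finset.Icc (-n) n).card := Finset.card_filter_le _ _
    rw [Int.card_Icc] at this
    omega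
  exact_mod_cast h1

lemma cutoff_eq {n : ℤ} (hn : 0 < n) (k : ℤ) :
    cutoff ((k : ℝ) / n) = if k ∈ lowFreq n then 1 else 0 := by
  have hn' : (0 : ℝ) < n := by exact_mod_cast hn
  unfold cutoff
  rw [Set.indicator_apply]
  refine if_congr ?_ rfl rfl
  rw [mem_lowFreq, mem_Ioo, lt_div_iff₀ hn', div_lt_iff₀ hn']
  have : (2 * |k| < n) ↔ (2 * |(k : ℝ)| < n) := by exact_mod_cast Iff.rfl
  rw [this, ← lt_div_iff₀' (two_pos : (0 : ℝ) < 2), abs_lt]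
  constructor <;> rintro ⟨h1, h2⟩ <;> constructor <;> linarith

/-- The complex envelope `ã + i b̃`. -/
def envC (f φ : ℝ → ℝ) (n : ℤ) (t : ℝ) : ℂ :=
  ∑ k ∈ lowFreq n, 2 * circCoeff (normPhase φ) (fun t => (f t : ℂ)) (k + n) *
    cexp (2 * π * I * k * normPhase φ t)

/-- The coefficient at k - n is the conjugate of the one at -k + n, so the sum over k - n is the
conjugate of the sum S over k + n. Hence ã = S + S̄ and b̃ = -i(S - S̄) are the two parts of 2S. -/
lemma env_eq {f φ : ℝ → ℝ} {n : ℤ} (hn : 0 < n) (hφ : numPeriods φ = n) (t : ℝ) :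
    envA f φ t = (envC f φ n t).re ∧ envB f φ t = (envC f φ n t).im := by
  set c := circCoeff (normPhase φ) (fun t => (f t : ℂ)) with hc
  set S := ∑ k ∈ lowFreq n, c (k + n) * cexp (2 * π * I * k * normPhase φ t) with hS
  have hT : ∑ k ∈ lowFreq n, c (k - n) * cexp (2 * π * I * k * normPhase φ t) =
      (starRingEnd ℂ) S := by
    rw [hS, map_sum]
    refine Finset.sum_nbij' (fun k => -k) (fun k => -k) ?_ ?_ ?_ ?_ ?_
    · intro k hk; rw [mem_lowFreq] at hk ⊢; rwa [abs_neg]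
    · intro k hk; rw [mem_lowFreq] at hk ⊢; rwa [abs_neg]
    · simp
    · simp
    · intro k _
      rw [map_mul, hc, conj_circCoeff, ← Complex.exp_conj]
      simp only [map_mul, Complex.conj_ofReal, Complex.conj_I, map_ofNat, map_intCast]
      congr 2
      · ring
      · push_cast; ring
  have hC : envC f φ n t = 2 * S := by
    unfold envC
    rw [hS, Finset.mul_sum]
    refine Finset.sum_congr rfl fun k _ => by rw [← hc]; ring
  have hplus : ∀ k : ℤ, phaseFourier φ f ((k : ℝ) + numPeriods φ) = c (k + n) := fun k => by
    rw [hφ, hc, ← phaseFourier_intCast]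
    push_cast; rfl
  have hminus : ∀ k : ℤ, phaseFourier φ f ((k : ℝ) - numPeriods φ) = c (k - n) := fun k => by
    rw [hφ, hc, ← phaseFourier_intCast]
    push_cast; rfl
  have htsum : ∀ w : ℤ → ℂ, phaseFourierInv φ (fun k => w k * cutoff (k / numPeriods φ)) t =
      ∑ k ∈ lowFreq n, w k * cexp (2 * π * I * k * normPhase φ t) := by
    intro w
    unfold phaseFourierInv
    rw [tsum_eq_sum (s := lowFreq n)]
    · refine Finset.sum_congr rfl fun k hk => ?_
      beta_reduce
      rw [hφ, cutoff_eq hn, if_pos hk, mul_one]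
    · intro k hk
      beta_reduce
      rw [hφ, cutoff_eq hn, if_neg hk, mul_zero, zero_mul]
  unfold envA envB
  rw [htsum, htsum, hC]
  simp only [hplus, hminus]
  constructor
  · simp only [add_mul, Finset.sum_add_distrib]
    rw [hT, ← hS]
    simp only [add_re, Complex.conj_re, mul_re, Complex.re_ofNat, Complex.im_ofNat]
    ring
  · have : ∀ k : ℤ, -I * (c (k + n) - c (k - n)) * cexp (2 * π * I * k * normPhase φ t) =
        -I * (c (k + n) * cexp (2 * π * I * k * normPhase φ t)
          - c (k - n) * cexp (2 * π * I * k * normPhase φ t)) := fun k => by ring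
    simp only [this, ← Finset.mul_sum]
    rw [Finset.sum_sub_distrib, hT, ← hS]
    simp only [neg_mul, neg_re, mul_re, I_re, I_im, sub_re, sub_im, Complex.conj_re,
      Complex.conj_im, mul_im, Complex.re_ofNat, Complex.im_ofNat]
    ring

/-- This is 2cos θ = e^{iθ} + e^{-iθ} with frequency shifts by multiples of n. Subtracting c is free
off frequency 0; it serves to remove the mean of f₀, for which no bound is assumed. -/
lemma two_mul_circCoeff_eq {φ θ f₀ f₁ : ℝ → ℝ} (hq : IsCircleDiffeo (normPhase φ)) {n : ℤ}
    (hn : 0 < n) (hφ : numPeriods φ = n) (hθ : Continuous θ) (hφc : Continuous φ)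
    (hf₀ : Continuous f₀) (hf₁ : Continuous f₁) (c : ℂ) {k : ℤ} (hk : k + n ≠ 0) :
    2 * circCoeff (normPhase φ) (fun t => ((f₀ t + f₁ t * Real.cos (θ t) : ℝ) : ℂ)) (k + n) =
      2 * circCoeff (normPhase φ) (fun t => ((f₀ t : ℝ) : ℂ) - c) (k + n)
      + circCoeff (normPhase φ)
        (fun t => (f₁ t : ℂ) * cexp (I * (1 : ℤ) * ((θ t - (φ t - φ 0) : ℝ) : ℂ))) k
      + circCoeff (normPhase φ)
        (fun t => (f₁ t : ℂ) * cexp (I * (-1 : ℤ) * ((θ t - (φ t - φ 0) : ℝ) : ℂ)))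
          (k + 2 * n) := by
  have hL : (n : ℝ) ≠ 0 := by exact_mod_cast hn.ne'
  rw [hq.circCoeff_sub (by fun_prop) continuous_const, hq.circCoeff_const, if_neg hk, sub_zero]
  have hqφ : ∀ t, φ t - φ 0 = 2 * π * n * normPhase φ t := fun t => by
    unfold normPhase
    rw [hφ]
    have := Real.pi_ne_zero
    field_simp
  unfold circCoeff
  rw [← intervalIntegral.integral_const_mul, ← intervalIntegral.integral_const_mul,
    ← intervalIntegral.integral_add, ← intervalIntegral.integral_add]
  · congr 1; ext t
    beta_reduce
    rw [hqφ]
    set x := normPhase φ t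
    set y := deriv (normPhase φ) t
    push_cast
    rw [Complex.cos]
    have e1 : cexp (I * 1 * (θ t - 2 * π * n * x)) * cexp (-(2 * π * I * k * x)) =
        cexp (θ t * I) * cexp (-(2 * π * I * (k + n) * x)) := by
      rw [← Complex.exp_add, ← Complex.exp_add]; ring_nf
    have e2 : cexp (I * -1 * (θ t - 2 * π * n * x)) * cexp (-(2 * π * I * (k + 2 * n) * x)) =
        cexp (-θ t * I) * cexp (-(2 * π * I * (k + n) * x)) := by
      rw [← Complex.exp_add, ← Complex.exp_add]; ring_nf
    linear_combination -(f₁ t * y : ℂ) * e1 - (f₁ t * y : ℂ) * e2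
  all_goals
    apply Continuous.intervalIntegrable
    have := hq.continuous
    have := hq.continuous_deriv
    fun_prop

/-! ### Angular velocity of a plane curve and the derivative of the arctangent. -/

/-- The isolated zeros form a discrete subspace of the line, and such a subspace is countable. -/
lemma countable_setOf_eq_zero_and_eventually_ne (A : ℝ → ℝ) :
    {t | A t = 0 ∧ ∀ᶠ s in nhdsWithin t {t}ᶜ, A s ≠ 0}.Countable := by
  refine IsLindelof.countable (HereditarilyLindelofSpace.isLindelof _) ?_
  rw [discreteTopology_subtype_iff]
  intro t ht
  rw [← disjoint_iff, Filter.disjoint_principal_right]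
  filter_upwards [ht.2] with s hs h using hs h.1

lemma abs_arctan_le_abs (x : ℝ) : |Real.arctan x| ≤ |x| := by
  have h := Convex.norm_image_sub_le_of_norm_hasDerivWithin_le (f := Real.arctan) (s := univ)
    (C := 1) (fun y _ => (Real.hasDerivAt_arctan y).hasDerivWithinAt) (fun y _ => by
      rw [Real.norm_eq_abs, abs_of_pos (by positivity), div_le_one (by positivity)]
      nlinarith [sq_nonneg y]) convex_univ (mem_univ 0) (mem_univ x)
  simpa using h

/-- The pointwise derivative of `arctan (B/A)` is almost everywhere the angular velocity of the
curve `(A, B)`. -/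
lemma ae_deriv_arctan_div {A B A' B' : ℝ → ℝ} (hA : ∀ t, HasDerivAt A (A' t) t)
    (hB : ∀ t, HasDerivAt B (B' t) t) :
    ∀ᵐ t, deriv (fun t => Real.arctan (B t / A t)) t =
      (A t * B' t - B t * A' t) / (A t ^ 2 + B t ^ 2) := by
  have h0 : ∀ᵐ t, t ∉ {t | A t = 0 ∧ ∀ᶠ s in nhdsWithin t {t}ᶜ, A s ≠ 0} :=
    (countable_setOf_eq_zero_and_eventually_ne A).ae_notMem volume
  filter_upwards [h0] with t ht
  by_cases h : A t = 0
  · have hfreq : ∃ᶠ s in nhdsWithin t {t}ᶜ, A s = 0 := fun hev => ht ⟨h, hev⟩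
    -- At a zero of A that is a limit of zeros both sides vanish: B/0 = 0 by convention, so the
    -- arctangent equals 0 along those zeros and its `deriv` is 0, whether or not it is
    -- differentiable there.
    have h1 : A' t = 0 := by
      rw [← (hA t).deriv]
      exact deriv_zero_of_frequently_const hfreq
    have h2 : deriv (fun t => Real.arctan (B t / A t)) t = 0 :=
      deriv_zero_of_frequently_const (c := 0) (hfreq.mono fun s hs => by simp [hs])
    rw [h2, h, h1]
    simp
  · have := (((hB t).div (hA t) h).arctan).deriv
    rw [show (fun t => Real.arctan (B t / A t)) = fun x => Real.arctan ((B / A) x) from rfl, this]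
    simp only [Pi.div_apply]
    have h1 : A t ^ 2 + B t ^ 2 ≠ 0 := by positivity
    have h2 : 1 + (B t / A t) ^ 2 ≠ 0 := by positivity
    field_simp

/-- Rotation by -D subtracts D' from the angular velocity. With positive real part the arctangent is
a smooth branch of the angle, even where A itself vanishes. -/
lemma hasDerivAt_arctan_rotated {A B D : ℝ → ℝ} {A' B' D' t : ℝ} (hA : HasDerivAt A A' t)
    (hB : HasDerivAt B B' t) (hD : HasDerivAt D D' t)
    (h0 : 0 < A t * Real.cos (D t) + B t * Real.sin (D t)) :
    HasDerivAt (fun t => Real.arctan ((B t * Real.cos (D t) - A t * Real.sin (D t)) /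
      (A t * Real.cos (D t) + B t * Real.sin (D t))))
      ((A t * B' - B t * A') / (A t ^ 2 + B t ^ 2) - D') t := by
  have hc := hD.cos
  have hs := hD.sin
  have hu := (hB.mul hc).sub (hA.mul hs)
  have hv := (hA.mul hc).add (hB.mul hs)
  refine ((hu.div hv (by simpa using h0.ne')).arctan).congr_deriv ?_
  have hcs := Real.cos_sq_add_sin_sq (D t)
  simp only [Pi.div_apply, Pi.sub_apply, Pi.add_apply, Pi.mul_apply]
  set c := Real.cos (D t)
  set s := Real.sin (D t)
  set a := A t
  set b := B t
  obtain ⟨u, hu⟩ : ∃ u, u = b * c - a * s := ⟨_, rfl⟩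
  obtain ⟨v, hv⟩ : ∃ v, v = a * c + b * s := ⟨_, rfl⟩
  rw [← hv] at h0
  have hab : a ^ 2 + b ^ 2 = v ^ 2 + u ^ 2 := by
    rw [hu, hv]; linear_combination -(a ^ 2 + b ^ 2) * hcs
  have hpos : v ^ 2 + u ^ 2 ≠ 0 := by positivity
  rw [hab, ← hu, ← hv]
  have h1 : 1 + (u / v) ^ 2 = (v ^ 2 + u ^ 2) / v ^ 2 := by field_simp
  have hnum : (B' * c + b * (-s * D') - (A' * s + a * (c * D'))) * v -
      u * (A' * c + a * (-s * D') + (B' * s + b * (c * D'))) =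
      (a * B' - b * A') - D' * (v ^ 2 + u ^ 2) := by
    rw [hu, hv]; linear_combination (a * B' - b * A') * hcs
  rw [hnum, h1]
  field_simp

/-- If the curve `(A, B)`, rotated back by the angle `D`, stays in a small sector around the
positive axis, then the low Fourier coefficients of its angular velocity are close to those
of `D'`. -/
lemma norm_coeff_deriv_arctan_sub_le {A B D A' B' D' : ℝ → ℝ} (hA : ∀ t, HasDerivAt A (A' t) t)
    (hB : ∀ t, HasDerivAt B (B' t) t) (hD : ∀ t, HasDerivAt D (D' t) t) (hA' : Continuous A')
    (hB' : Continuous B') (hD' : Continuous D') (hA1 : A 1 = A 0) (hB1 : B 1 = B 0)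
    (hc1 : Real.cos (D 1) = Real.cos (D 0)) (hs1 : Real.sin (D 1) = Real.sin (D 0)) {m E : ℝ}
    (hm : 0 < m) (hv : ∀ t ∈ Icc (0 : ℝ) 1, m ≤ A t * Real.cos (D t) + B t * Real.sin (D t))
    (hu : ∀ t ∈ Icc (0 : ℝ) 1, |B t * Real.cos (D t) - A t * Real.sin (D t)| ≤ E) (k : ℤ) :
    ‖coeff (deriv fun t => Real.arctan (B t / A t)) k - coeff D' k‖ ≤
      2 * π * |(k : ℝ)| * (E / m) := by
  have cA : Continuous A := continuous_iff_continuousAt.2 fun t => (hA t).continuousAt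
  have cB : Continuous B := continuous_iff_continuousAt.2 fun t => (hB t).continuousAt
  have cD : Continuous D := continuous_iff_continuousAt.2 fun t => (hD t).continuousAt
  set F : ℝ → ℝ := fun t => (A t * B' t - B t * A' t) / (A t ^ 2 + B t ^ 2) with hF
  set κ : ℝ → ℝ := fun t => Real.arctan ((B t * Real.cos (D t) - A t * Real.sin (D t)) /
      (A t * Real.cos (D t) + B t * Real.sin (D t))) with hκ
  have hne : ∀ t ∈ Icc (0 : ℝ) 1, A t ^ 2 + B t ^ 2 ≠ 0 := by
    intro t ht h
    have h1 : A t = 0 := by nlinarith [sq_nonneg (A t), sq_nonneg (B t)]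
    have h2 : B t = 0 := by nlinarith [sq_nonneg (A t), sq_nonneg (B t)]
    have := hv t ht
    rw [h1, h2] at this
    simp only [zero_mul, add_zero] at this
    linarith
  have hFc : ContinuousOn F (Icc 0 1) := by
    apply ContinuousOn.div (by fun_prop) (by fun_prop) hne
  have hκd : ∀ t ∈ Icc (0 : ℝ) 1, HasDerivAt κ (F t - D' t) t := fun t ht =>
    hasDerivAt_arctan_rotated (hA t) (hB t) (hD t) (hm.trans_le (hv t ht))
  set e : ℝ → ℂ := fun t => cexp (-(2 * π * I * k * t)) with he
  have hec : Continuous e := by fun_prop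
  have hed : ∀ t : ℝ, HasDerivAt e (e t * -(2 * π * I * k)) t := fun t => by
    have h1 : HasDerivAt (fun z : ℂ => -(2 * π * I * k * z)) (-(2 * π * I * k * 1)) (t : ℂ) :=
      ((hasDerivAt_id (t : ℂ)).const_mul (2 * π * I * k : ℂ)).neg
    have h2 := h1.cexp.comp_ofReal
    rw [mul_one] at h2
    exact h2
  have hI1 : coeff (deriv fun t => Real.arctan (B t / A t)) k =
      ∫ t in (0 : ℝ)..1, (F t : ℂ) * e t := by
    rw [coeff_eq_integral]
    apply intervalIntegral.integral_congr_ae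
    filter_upwards [ae_deriv_arctan_div hA hB] with t ht _
    rw [ht]
  have huIcc : uIcc (0 : ℝ) 1 = Icc 0 1 := uIcc_of_le zero_le_one
  have hI2 : coeff (deriv fun t => Real.arctan (B t / A t)) k - coeff D' k =
      ∫ t in (0 : ℝ)..1, e t * ((F t - D' t : ℝ) : ℂ) := by
    rw [hI1, coeff_eq_integral, ← intervalIntegral.integral_sub]
    · congr 1; ext t
      push_cast
      ring
    · apply ContinuousOn.intervalIntegrable
      rw [huIcc]
      exact (Complex.continuous_ofReal.comp_continuousOn hFc).mul hec.continuousOn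
    · apply Continuous.intervalIntegrable
      fun_prop
  -- The angle κ of the rotated curve is periodic, so the boundary terms cancel and 2πik times a
  -- coefficient of κ remains. The factor k makes the comparison exact at k = 0.
  have hparts := intervalIntegral.integral_mul_deriv_eq_deriv_mul (a := 0) (b := 1) (u := e)
    (v := fun t => (κ t : ℂ)) (u' := fun t => e t * -(2 * π * I * k))
    (v' := fun t => ((F t - D' t : ℝ) : ℂ)) (fun t _ => hed t)
    (fun t ht => (hκd t (huIcc ▸ ht)).ofReal_comp)
    (by apply Continuous.intervalIntegrable; fun_prop)
    (by
      apply ContinuousOn.intervalIntegrable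
      rw [huIcc]
      exact Complex.continuous_ofReal.comp_continuousOn (hFc.sub hD'.continuousOn))
  have hκ1 : κ 1 = κ 0 := by simp only [hκ, hA1, hB1, hc1, hs1]
  have he1 : e 1 = 1 := by
    simp only [he]
    rw [show -(2 * π * I * k * (1 : ℝ)) = ((-k : ℤ) : ℂ) * (2 * π * I) by push_cast; ring]
    exact Complex.exp_int_mul_two_pi_mul_I _
  have he0 : e 0 = 1 := by simp [he]
  rw [hI2, hparts, hκ1, he1, he0, sub_self, zero_sub, norm_neg]
  have hbound := intervalIntegral.norm_integral_le_of_norm_le_const (a := 0) (b := 1)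
    (f := fun t => e t * -(2 * π * I * k) * (κ t : ℂ)) (C := 2 * π * |(k : ℝ)| * (E / m))
    (fun t ht => by
      rw [uIoc_of_le zero_le_one] at ht
      have ht' := Ioc_subset_Icc_self ht
      have n1 : ‖e t‖ = 1 := by
        simp only [he]
        rw [show -(2 * π * I * k * t) = 2 * π * I * ((-k : ℤ) : ℂ) * t by push_cast; ring]
        exact norm_cexp_ofReal_freq _ _
      have n2 : ‖-(2 * π * I * k : ℂ)‖ = 2 * π * |(k : ℝ)| := by
        simp [abs_of_pos Real.pi_pos]
      have n3 : |κ t| ≤ E / m := by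
        refine (abs_arctan_le_abs _).trans ?_
        rw [abs_div, abs_of_pos (hm.trans_le (hv t ht'))]
        have := (abs_nonneg _).trans (hu t ht')
        exact div_le_div₀ this (hu t ht') hm (hv t ht')
      rw [norm_mul, norm_mul, n1, one_mul, n2, Complex.norm_real, Real.norm_eq_abs]
      gcongr)
  simpa using hbound

/-! ### Error of the computed envelope. -/

lemma IsCircleDiffeo.norm_circCoeff_le_add {q : ℝ → ℝ} (hq : IsCircleDiffeo q) {W G : ℝ → ℂ}
    (hW : Continuous W) (hG : Continuous G) {E b : ℝ}
    (hE : ∀ t ∈ Icc (0 : ℝ) 1, ‖W t - G t‖ ≤ E) {k : ℤ} (hb : ‖circCoeff q G k‖ ≤ b) :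
    ‖circCoeff q W k‖ ≤ 2 * E + b := by
  have h := hq.norm_circCoeff_le hE k
  rw [hq.circCoeff_sub hW hG] at h
  have := norm_le_norm_sub_add (circCoeff q W k) (circCoeff q G k)
  linarith

/-- Error of a low-pass filter: `W₁` is recovered up to the coefficients of `W₀`, `W₂` at high
frequencies. -/
lemma norm_sum_lowFreq_sub_le {q : ℝ → ℝ} (hq : IsCircleDiffeo q) {n : ℤ} (hn : 0 < n)
    {W₀ W₁ W₂ G : ℝ → ℂ} (hW₁ : Continuous W₁) (hG : Continuous G)
    (hper : Function.Periodic G 1) {E H K p Y : ℝ} (hK : 0 ≤ K) (hp : 2 ≤ p) (hY : 1 ≤ Y)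
    (hYn : 2 * Y ≤ n) (hE : ∀ t ∈ Icc (0 : ℝ) 1, ‖W₁ t - G t‖ ≤ E)
    (hGc : ∀ k : ℤ, Y ≤ |(k : ℝ)| → ‖circCoeff q G k‖ ≤ K * |(k : ℝ)| ^ (-p))
    (h₀ : ∀ k : ℤ, Y ≤ |(k : ℝ)| → ‖circCoeff q W₀ k‖ ≤ H)
    (h₂ : ∀ k : ℤ, Y ≤ |(k : ℝ)| → ‖circCoeff q W₂ k‖ ≤ H) {t : ℝ} (ht : t ∈ Icc (0 : ℝ) 1) :
    ‖∑ k ∈ lowFreq n, (2 * circCoeff q W₀ (k + n) + circCoeff q W₁ k +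
        circCoeff q W₂ (k + 2 * n)) * cexp (2 * π * I * k * q t) - W₁ t‖ ≤
      3 * n * (3 * H + 2 * E) + E + 4 * K * Y ^ (1 - p) := by
  have hlow : ∀ k ∈ lowFreq n, 2 * |(k : ℝ)| < n := fun k hk => by
    exact_mod_cast mem_lowFreq.1 hk
  have hE0 : 0 ≤ E := (norm_nonneg _).trans (hE t ht)
  have hH0 : 0 ≤ H := by
    refine (norm_nonneg _).trans (h₀ n ?_)
    have := le_abs_self (n : ℝ)
    linarith
  -- Only W₁ - G and the displaced terms are estimated coefficient by coefficient over the band; G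
  -- itself leaves nothing but its tail.
  have e : ∑ k ∈ lowFreq n, (2 * circCoeff q W₀ (k + n) + circCoeff q W₁ k +
        circCoeff q W₂ (k + 2 * n)) * cexp (2 * π * I * k * q t) - W₁ t =
      ∑ k ∈ lowFreq n, (2 * circCoeff q W₀ (k + n) + circCoeff q (fun t => W₁ t - G t) k +
        circCoeff q W₂ (k + 2 * n)) * cexp (2 * π * I * k * q t) -
      (W₁ t - G t) - (G t - ∑ k ∈ lowFreq n, circCoeff q G k * cexp (2 * π * I * k * q t)) := by
    have : ∀ k : ℤ, circCoeff q W₁ k = circCoeff q (fun t => W₁ t - G t) k + circCoeff q G k :=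
      fun k => by rw [hq.circCoeff_sub hW₁ hG, sub_add_cancel]
    simp only [this, add_mul, Finset.sum_add_distrib]
    ring
  rw [e]
  refine (norm_sub_le _ _).trans (add_le_add ((norm_sub_le _ _).trans
    (add_le_add ?_ (hE t ht))) ?_)
  · calc _ ≤ ∑ k ∈ lowFreq n, (3 * H + 2 * E) := by
          refine norm_sum_le_of_le _ fun k hk => ?_
          have hk2 := hlow k hk
          rw [norm_mul, norm_cexp_ofReal_freq, mul_one]
          have a1 := neg_abs_le (k : ℝ)
          -- In the band |k| < n/2, so the displaced frequencies k + n and k + 2n exceed n/2 ≥ Y.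
          have b0 := h₀ (k + n) (by
            push_cast
            have := le_abs_self ((k : ℝ) + n)
            linarith)
          have b2 := h₂ (k + 2 * n) (by
            push_cast
            have := le_abs_self ((k : ℝ) + 2 * n)
            linarith)
          have b1 := hq.norm_circCoeff_le hE k
          refine (norm_add_le _ _).trans ((add_le_add ((norm_add_le _ _).trans
            (add_le_add (norm_mul_le _ _) b1)) b2).trans ?_)
          rw [Complex.norm_ofNat]
          linarith
      _ ≤ _ := by
          rw [Finset.sum_const, nsmul_eq_mul]
          have := card_lowFreq_le hn
          gcongr
  · refine hq.norm_sub_trunc_le hG hper hK hp hY (fun k hk => ?_) (fun k hk => ?_) t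
    · rw [mem_lowFreq, not_lt] at hk
      have : (n : ℝ) ≤ 2 * |(k : ℝ)| := by exact_mod_cast hk
      linarith
    · apply hGc
      rw [mem_lowFreq, not_lt] at hk
      have : (n : ℝ) ≤ 2 * |(k : ℝ)| := by exact_mod_cast hk
      linarith

lemma IsPhase.sub_eq_trigPrim {φ : ℝ → ℝ} (hφ : IsPhase φ) {d : ℤ → ℂ} {M : ℕ}
    (hd : ∀ t : ℝ, ((deriv φ t : ℝ) : ℂ) = trigPoly d M t) (t : ℝ) :
    ((φ t - φ 0 : ℝ) : ℂ) = trigPrim d M t := by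
  have hder : ∀ t : ℝ, HasDerivAt (fun t : ℝ => ((φ t - φ 0 : ℝ) : ℂ) - trigPrim d M t) 0 t := by
    intro t
    have := ((hφ.hasDerivAt t).sub_const (φ 0)).ofReal_comp.sub
      (hasDerivAt_trigPrim d M t).comp_ofReal
    rwa [hd t, sub_self] at this
  have := is_const_of_deriv_eq_zero (fun t => (hder t).differentiableAt)
    (fun t => (hder t).deriv) t 0
  simp only [sub_self, Complex.ofReal_zero, trigPrim_zero] at this
  exact sub_eq_zero.1 this

/-- The constant in the error bound for the computed envelope. -/
def constEnv (B C C₁ p R : ℝ) (M : ℕ) : ℝ :=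
  193 * p * ((3 + 32 * C + 2 * B) * (4 * C)) + 76 * (2 * constStrip B C C₁ p R M)

/-- Each coefficient has an error of order X^{1-p}, and the band contains O(X) of them. This count
costs the power that turns 1 - p into the exponent 2 - p of the theorem. -/
lemma envelope_error_le {p X Y n' E K A : ℝ} (hp : 4 ≤ p) (hX : 1 ≤ X) (hYX : Y = p * X)
    (hK : 0 ≤ K) (hA : 0 ≤ A) (hn : n' ≤ 8 * Y) (hE : E = A * X ^ (1 - p)) :
    3 * n' * (3 * (2 * E + K * Y ^ (-p)) + 2 * E) + E + 4 * K * Y ^ (1 - p) ≤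
      (193 * p * A + 76 * K) * X ^ (2 - p) := by
  have hY : 0 < Y := by rw [hYX]; positivity
  have hXY : X ≤ Y := by rw [hYX]; nlinarith
  have hXp : X ^ (2 - p) = X * X ^ (1 - p) := by
    rw [show 2 - p = (1 - p) + 1 by ring, Real.rpow_add_one (by linarith)]; ring
  have hYp : Y ^ (1 - p) = Y * Y ^ (-p) := by
    rw [show 1 - p = -p + 1 by ring, Real.rpow_add_one hY.ne']; ring
  have hYX1 : Y ^ (1 - p) ≤ X ^ (1 - p) :=
    Real.rpow_le_rpow_of_nonpos (by linarith) hXY (by linarith)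
  have hu0 : 0 ≤ X ^ (1 - p) := by positivity
  have hE0 : 0 ≤ E := by rw [hE]; positivity
  have hv0 : 0 ≤ Y ^ (-p) := by positivity
  have e1 : E ≤ Y * E := le_mul_of_one_le_left hE0 (by linarith)
  have e2 : Y ^ (1 - p) ≤ X * X ^ (1 - p) := hYX1.trans (le_mul_of_one_le_left hu0 hX)
  calc 3 * n' * (3 * (2 * E + K * Y ^ (-p)) + 2 * E) + E + 4 * K * Y ^ (1 - p)
      ≤ 3 * (8 * Y) * (3 * (2 * E + K * Y ^ (-p)) + 2 * E) + E + 4 * K * Y ^ (1 - p) := by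
        gcongr
    _ = 192 * Y * E + E + 76 * K * Y ^ (1 - p) := by rw [hYp]; ring
    _ ≤ 192 * Y * E + Y * E + 76 * K * (X * X ^ (1 - p)) := by gcongr
    _ = _ := by rw [hE, hYX, hXp]; ring

set_option maxHeartbeats 400000 in
-- Two scales are at work: series are truncated at X = L/(4p), where the strip weights are still
-- quadratic, and coefficients are small from Y = L/4 = pX on.
lemma norm_envC_sub_le {θ φ f₀ f₁ : ℝ → ℝ} (hθ : IsPhase θ) (hφ : IsPhase φ)
    (hqθ : IsCircleDiffeo (normPhase θ)) (hqφ : IsCircleDiffeo (normPhase φ))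
    (hf₀ : Continuous f₀) (hf₀1 : Function.Periodic f₀ 1)
    (hf₁ : Continuous f₁) (hf₁1 : Function.Periodic f₁ 1)
    {B C C₁ p R X : ℝ} {M : ℕ} {n' : ℤ} {d : ℤ → ℂ}
    (hB : 0 ≤ B) (hC : 0 ≤ C) (hC₁ : 0 ≤ C₁) (hp : 4 ≤ p)
    (hX : 1 ≤ X) (hLX : numPeriods θ = 4 * p * X) (hX1 : 4 * C * X ^ (1 - p) ≤ 1) (hMX : M ≤ X)
    (hn' : numPeriods φ = n') (hLL : |numPeriods θ - n'| ≤ R)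
    (hL1 : numPeriods θ ≤ 2 * n') (hL2 : n' ≤ 2 * numPeriods θ)
    (hT : constTrig C₁ p M ≤ 2 * p * Real.log (numPeriods θ))
    (hT' : constTrig C₁ p M ≤ 2 * π * n')
    (ha : ∀ k : ℤ, k ≠ 0 → ‖coeff (deriv θ) k‖ ≤ C * |(k : ℝ)| ^ (-p))
    (hφ' : ∀ t : ℝ, ((deriv φ t : ℝ) : ℂ) = trigPoly d M t) (hd0 : d 0 = 2 * π * n')
    (hd : ∀ k : ℤ, k ≠ 0 → ‖d k‖ ≤ C₁)
    (hc₀ : ∀ k : ℤ, k ≠ 0 → ‖phaseFourier θ f₀ k‖ ≤ C * |(k : ℝ)| ^ (-p))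
    (hc₁ : ∀ k : ℤ, k ≠ 0 → ‖phaseFourier θ f₁ k‖ ≤ C * |(k : ℝ)| ^ (-p))
    (hc₁0 : ‖phaseFourier θ f₁ ((0 : ℤ) : ℝ)‖ ≤ B) {t : ℝ} (ht : t ∈ Icc (0 : ℝ) 1) :
    ‖envC (fun s => f₀ s + f₁ s * Real.cos (θ s)) φ n' t -
      f₁ t * cexp (I * (1 : ℤ) * ((θ t - (φ t - φ 0) : ℝ) : ℂ))‖ ≤
      constEnv B C C₁ p R M * X ^ (2 - p) := by
  obtain ⟨n, hn, -⟩ := hθ.exists_numPeriods_eq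
  set L := numPeriods θ with hLdef
  have hpX : 4 ≤ p * X := by nlinarith
  have hLe : rexp 1 ≤ L := by
    have := Real.exp_one_lt_d9
    rw [hLX]; linarith
  have hL0 : 0 < L := (Real.exp_pos 1).trans_le hLe
  have hn'0 : (0 : ℝ) < n' := by linarith
  have hn'pos : 0 < n' := by exact_mod_cast hn'0
  set N := ⌊X⌋₊ with hN
  have hNX : (N : ℝ) ≤ X := Nat.floor_le (by linarith)
  have hXN : X ≤ N + 1 := (Nat.lt_floor_add_one X).le
  have hNL : 4 * p * N ≤ L := by rw [hLX]; gcongr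
  have hML : 4 * p * M ≤ L := by rw [hLX]; gcongr
  have hXL : X ≤ L := by rw [hLX]; nlinarith
  have hψ : ∀ t : ℝ, ((φ t - φ 0 : ℝ) : ℂ) = trigPrim d M t := hφ.sub_eq_trigPrim hφ'
  have hq : ∀ t : ℝ, (normPhase φ t : ℂ) = trigPrim d M t / (2 * π * (n' : ℝ)) := fun t => by
    rw [← hψ]; unfold normPhase; rw [hn']; push_cast; rfl
  have hq' : ∀ t : ℝ, ((deriv (normPhase φ) t : ℝ) : ℂ) =
      trigPoly d M t / (2 * π * (n' : ℝ)) := fun t => by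
    rw [deriv_normPhase, hn', ← hφ']; push_cast; rfl
  have ha0 : coeff (deriv θ) 0 = 2 * π * L := hθ.coeff_deriv_zero
  have hd0' : d 0 = 2 * π * (n' : ℝ) := by rw [hd0]; push_cast; rfl
  set K := 2 * constStrip B C C₁ p R M with hK
  have hK0 : 0 ≤ K := by
    have : 0 ≤ constPhase C p := by unfold constPhase; positivity
    rw [hK]; unfold constStrip; positivity
  set D := 4 * C * X ^ (1 - p) with hD
  set E := (3 + 32 * C + 2 * B) * D with hE
  -- The three contributions are treated at once: σ = 0 for the centred f₀, σ = 1 for the wanted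
  -- term f₁e^{iΔ}, σ = -1 for its displaced conjugate.
  set Z : (ℝ → ℂ) → ℤ → ℝ → ℂ := fun g σ t =>
    g t * cexp (I * σ * ((θ t - (φ t - φ 0) : ℝ) : ℂ)) with hZ
  set G : (ℝ → ℂ) → ℤ → ℝ → ℂ := fun g σ t => entireApprox (circCoeff (normPhase θ) g)
    (coeff (deriv θ)) d N M L (θ 0) σ t with hG
  have hθc := hθ.continuous
  have hφc := hφ.continuous
  have hZc : ∀ g σ, Continuous g → Continuous (Z g σ) := fun g σ hg => by
    simp only [hZ]; fun_prop
  have hGc : ∀ g σ, Continuous (G g σ) := fun g σ =>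
    (differentiable_entireApprox _ _ _ _ _ _ _ _).continuous.comp Complex.continuous_ofReal
  have hZG : ∀ g : ℝ → ℂ, Continuous g → Function.Periodic g 1 →
      ‖circCoeff (normPhase θ) g 0‖ ≤ B →
      (∀ k : ℤ, k ≠ 0 → ‖circCoeff (normPhase θ) g k‖ ≤ C * |(k : ℝ)| ^ (-p)) →
      ∀ σ : ℤ, |σ| ≤ 1 → (∀ t ∈ Icc (0 : ℝ) 1, ‖Z g σ t - G g σ t‖ ≤ E) ∧
        ∀ k : ℤ, L ≤ 4 * |(k : ℝ)| →
          ‖circCoeff (normPhase φ) (G g σ) k‖ ≤ K * |(k : ℝ)| ^ (-p) := by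
    intro g hg hg1 hg0 hgk σ hσ
    refine ⟨fun t ht => ?_, fun k hk => ?_⟩
    · exact norm_mul_cexp_sub_entireApprox_le (ψ := fun t => φ t - φ 0) hθ hqθ hg hg1 hB hC hp hX
        hX1 hXN (hNX.trans hXL) hL0 ha hg0 hgk hψ hσ ht
    · exact norm_circCoeff_entireApprox_le (L' := n') hC hC₁ hp hLe hNL hML hLL hL1 hT hT' hn rfl
        ha0 ha hd0' hd hg0 hgk (θ 0) hσ hq hq' hk
  set Y := L / 4 with hY
  have hYX : Y = p * X := by rw [hY, hLX]; ring
  have hY1 : 1 ≤ Y := by rw [hYX]; linarith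
  have hXY : X ≤ Y := by rw [hYX]; nlinarith
  have hYk : ∀ k : ℤ, Y ≤ |(k : ℝ)| → L ≤ 4 * |(k : ℝ)| := fun k hk => by linarith
  have hcoef : ∀ g : ℝ → ℂ, Continuous g → Function.Periodic g 1 →
      ‖circCoeff (normPhase θ) g 0‖ ≤ B →
      (∀ k : ℤ, k ≠ 0 → ‖circCoeff (normPhase θ) g k‖ ≤ C * |(k : ℝ)| ^ (-p)) →
      ∀ σ : ℤ, |σ| ≤ 1 → ∀ k : ℤ, Y ≤ |(k : ℝ)| →
        ‖circCoeff (normPhase φ) (Z g σ) k‖ ≤ 2 * E + K * Y ^ (-p) := by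
    intro g hg hg1 hg0 hgk σ hσ k hk
    obtain ⟨h1, h2⟩ := hZG g hg hg1 hg0 hgk σ hσ
    refine hqφ.norm_circCoeff_le_add (hZc g σ hg) (hGc g σ) h1 ((h2 k (hYk k hk)).trans ?_)
    gcongr K * ?_
    exact Real.rpow_le_rpow_of_nonpos (by linarith) hk (by linarith)
  -- the centred low-frequency part
  set c₀ := circCoeff (normPhase θ) (fun t => (f₀ t : ℂ)) 0 with hc₀def
  set g₀ : ℝ → ℂ := fun t => (f₀ t : ℂ) - c₀ with hg₀
  have hf₀c : Continuous fun t => (f₀ t : ℂ) := by fun_prop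
  have hf₁c : Continuous fun t => (f₁ t : ℂ) := by fun_prop
  have hf₁p : Function.Periodic (fun t => (f₁ t : ℂ)) 1 := fun t => by simp only [hf₁1 t]
  have hg₀p : Function.Periodic g₀ 1 := fun t => by simp only [hg₀, hf₀1 t]
  have hg₀c : Continuous g₀ := hf₀c.sub continuous_const
  have hg₀k : ∀ k : ℤ, circCoeff (normPhase θ) g₀ k =
      circCoeff (normPhase θ) (fun t => (f₀ t : ℂ)) k - if k = 0 then c₀ else 0 := fun k => by
    rw [hg₀, hqθ.circCoeff_sub hf₀c continuous_const, hqθ.circCoeff_const]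
  have b₀ := hcoef g₀ hg₀c hg₀p (by rw [hg₀k, if_pos rfl, sub_self, norm_zero]; exact hB)
    (fun k hk => by
      rw [hg₀k, if_neg hk, sub_zero, ← phaseFourier_intCast]; exact hc₀ k hk) 0 (by simp)
  have hZ0 : Z g₀ 0 = g₀ := by
    ext t; simp [hZ]
  rw [hZ0] at b₀
  rw [phaseFourier_intCast] at hc₁0
  have hc₁' : ∀ k : ℤ, k ≠ 0 → ‖circCoeff (normPhase θ) (fun t => (f₁ t : ℂ)) k‖ ≤
      C * |(k : ℝ)| ^ (-p) := fun k hk => by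
    rw [← phaseFourier_intCast]; exact hc₁ k hk
  have b₂ := hcoef _ hf₁c hf₁p hc₁0 hc₁' (-1) (by simp)
  obtain ⟨h1, h2⟩ := hZG _ hf₁c hf₁p hc₁0 hc₁' 1 (by simp)
  have hGper : Function.Periodic (G (fun t => (f₁ t : ℂ)) 1) 1 := fun t => by
    simp only [hG]
    push_cast
    exact entireApprox_add_one hn hL0 (by rw [ha0, hn]; simp) hd0 t
  have hmain := norm_sum_lowFreq_sub_le hqφ hn'pos (W₀ := g₀) (hZc _ 1 hf₁c) (hGc _ 1) hGper hK0
    (by linarith : 2 ≤ p) hY1 (by linarith) h1 (fun k hk => h2 k (hYk k hk)) b₀ b₂ ht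
  have henv : envC (fun s => f₀ s + f₁ s * Real.cos (θ s)) φ n' t =
      ∑ k ∈ lowFreq n', (2 * circCoeff (normPhase φ) g₀ (k + n') +
        circCoeff (normPhase φ) (Z (fun t => (f₁ t : ℂ)) 1) k +
        circCoeff (normPhase φ) (Z (fun t => (f₁ t : ℂ)) (-1)) (k + 2 * n')) *
        cexp (2 * π * I * k * normPhase φ t) := by
    unfold envC
    refine Finset.sum_congr rfl fun k hk => ?_
    rw [two_mul_circCoeff_eq hqφ hn'pos hn' hθc hφc hf₀ hf₁ c₀]
    have := mem_lowFreq.1 hk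
    have := neg_abs_le k
    have := abs_nonneg k
    omega
  rw [henv]
  refine hmain.trans ?_
  have := envelope_error_le (n' := (n' : ℝ)) (E := E)
    (A := (3 + 32 * C + 2 * B) * (4 * C)) hp hX hYX hK0 (by positivity) (by rw [hY]; linarith)
    (by rw [hE, hD]; ring)
  unfold constEnv
  rwa [← hK]

/-! ### Ordinary Fourier coefficients, the ℓ¹ norm and the projection onto V_M. -/

lemma coeff_sub {g h : ℝ → ℝ} (hg : Continuous g) (hh : Continuous h) (k : ℤ) :
    coeff (fun t => g t - h t) k = coeff g k - coeff h k := by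
  simp only [coeff_eq_circCoeff]
  rw [← isCircleDiffeo_id.circCoeff_sub (by fun_prop) (by fun_prop)]
  simp only [Complex.ofReal_sub]

lemma coeff_add {g h : ℝ → ℝ} (hg : Continuous g) (hh : Continuous h) (k : ℤ) :
    coeff (fun t => g t + h t) k = coeff g k + coeff h k := by
  simp only [coeff_eq_circCoeff]
  rw [← isCircleDiffeo_id.circCoeff_add (by fun_prop) (by fun_prop)]
  simp only [Complex.ofReal_add]

lemma conj_coeff (g : ℝ → ℝ) (k : ℤ) : (starRingEnd ℂ) (coeff g k) = coeff g (-k) := by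
  simp only [coeff_eq_circCoeff]
  exact conj_circCoeff _ g k

lemma coeff_zero_eq_integral (g : ℝ → ℝ) : coeff g 0 = ((∫ t in (0 : ℝ)..1, g t : ℝ) : ℂ) := by
  rw [coeff_eq_integral]
  simp only [Int.cast_zero, mul_zero, zero_mul, neg_zero, Complex.exp_zero, mul_one]
  exact intervalIntegral.integral_ofReal

lemma norm_coeff_le_of_l1Norm_le {g : ℝ → ℝ} {R : ℝ} (hR : 0 ≤ R)
    (h : l1Norm g ≤ ENNReal.ofReal R) (k : ℤ) : ‖coeff g k‖ ≤ R := by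
  have h1 : ‖coeff g k‖ₑ ≤ ENNReal.ofReal R := (ENNReal.le_tsum k).trans h
  rw [← ofReal_norm] at h1
  exact (ENNReal.ofReal_le_ofReal_iff hR).1 h1

lemma abs_le_of_l1Norm_le {g : ℝ → ℝ} (hg : Continuous g) (hper : Function.Periodic g 1) {R : ℝ}
    (hR : 0 ≤ R) (h : l1Norm g ≤ ENNReal.ofReal R) (t : ℝ) : |g t| ≤ R := by
  have hne : ∑' k : ℤ, ENNReal.ofReal ‖coeff g k‖ ≠ ⊤ := by
    simp only [ofReal_norm]
    exact ne_top_of_le_ne_top ENNReal.ofReal_ne_top h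
  have hs : Summable fun k : ℤ => ‖coeff g k‖ := by
    have := ENNReal.summable_toReal hne
    simpa only [ENNReal.toReal_ofReal (norm_nonneg _)] using this
  have hsum : ∑' k : ℤ, ‖coeff g k‖ ≤ R := by
    rw [← ENNReal.ofReal_le_ofReal_iff hR, ENNReal.ofReal_tsum_of_nonneg
      (fun k => norm_nonneg _) hs]
    simp only [ofReal_norm]
    exact h
  have h1 := isCircleDiffeo_id.norm_sub_sum_le (g := fun t => (g t : ℂ)) (S := ∅) (by fun_prop)
    (fun t => by simp only [hper t]) hs (fun k _ => by rw [coeff_eq_circCoeff])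
    (fun k => norm_nonneg _) t
  rw [Finset.sum_empty, sub_zero, Complex.norm_real, Real.norm_eq_abs] at h1
  exact h1.trans hsum

lemma integral_trigPoly_mul_cexp (b : ℤ → ℂ) (M : ℕ) (k : ℤ) :
    ∫ t in (0 : ℝ)..1, trigPoly b M t * cexp (-(2 * π * I * k * t)) =
      if k ∈ Finset.Icc (-(M : ℤ)) M then b k else 0 := by
  have h1 : ∀ j : ℤ, ∫ t in (0 : ℝ)..1, b j * cexp (2 * π * I * j * t) *
      cexp (-(2 * π * I * k * t)) = if k = j then b j else 0 := by
    intro j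
    have h := isCircleDiffeo_id.circCoeff_const (b j) (k - j)
    unfold circCoeff at h
    simp only [sub_eq_zero, deriv_id'', Complex.ofReal_one, mul_one] at h
    rw [← h]
    congr 1; ext t
    rw [mul_assoc, ← Complex.exp_add]
    congr 2
    push_cast
    ring
  unfold trigPoly
  simp only [Finset.sum_mul]
  rw [intervalIntegral.integral_finsetSum]
  · simp only [h1]
    exact Finset.sum_ite_eq _ k b
  · intro j _
    apply Continuous.intervalIntegrable
    fun_prop

lemma coeff_of_eq_trigPoly {g : ℝ → ℝ} {b : ℤ → ℂ} {M : ℕ}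
    (h : ∀ t : ℝ, (g t : ℂ) = trigPoly b M t) (k : ℤ) :
    coeff g k = if k ∈ Finset.Icc (-(M : ℤ)) M then b k else 0 := by
  rw [coeff_eq_integral, ← integral_trigPoly_mul_cexp]
  simp only [h]

lemma trigPoly_congr {b c : ℤ → ℂ} {M : ℕ} (h : ∀ k ∈ Finset.Icc (-(M : ℤ)) M, b k = c k) (z : ℂ) :
    trigPoly b M z = trigPoly c M z :=
  Finset.sum_congr rfl fun k hk => by rw [h k hk]

lemma exists_eq_trigPoly_of_mem {w : ℝ → ℂ} {M : ℕ} (h : w ∈ trigSpace M) :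
    ∃ b : ℤ → ℂ, ∀ t : ℝ, w t = trigPoly b M t := by
  unfold trigSpace at h
  induction h using Submodule.span_induction with
  | mem x hx =>
    obtain ⟨k, hk, rfl⟩ := hx
    refine ⟨Pi.single k 1, fun t => ?_⟩
    unfold trigPoly
    rw [Finset.sum_eq_single k]
    · simp
    · intro j _ hj; simp [hj]
    · intro hk'; exact absurd (Finset.mem_Icc.2 hk) hk'
  | zero => exact ⟨0, fun t => by simp [trigPoly]⟩
  | add x y _ _ hx hy =>
    obtain ⟨b, hb⟩ := hx
    obtain ⟨c, hc⟩ := hy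
    refine ⟨b + c, fun t => ?_⟩
    simp only [Pi.add_apply, hb, hc, trigPoly, add_mul, Finset.sum_add_distrib]
  | smul a x _ hx =>
    obtain ⟨b, hb⟩ := hx
    refine ⟨a • b, fun t => ?_⟩
    simp only [Pi.smul_apply, hb, trigPoly, smul_eq_mul, Finset.mul_sum, mul_assoc]

lemma trigPoly_mem_trigSpace (b : ℤ → ℂ) (M : ℕ) :
    (fun t : ℝ => trigPoly b M t) ∈ trigSpace M := by
  have : (fun t : ℝ => trigPoly b M t) = ∑ k ∈ Finset.Icc (-(M : ℤ)) M,
      b k • fun t : ℝ => cexp (2 * π * I * k * t) := by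
    ext t
    simp [trigPoly]
  rw [this]
  exact Submodule.sum_mem _ fun k hk => Submodule.smul_mem _ _
    (Submodule.subset_span ⟨k, Finset.mem_Icc.1 hk, rfl⟩)

/-- Conjugate symmetry of the coefficients over a symmetric range makes the sum real, so the real
part in `trigProj` discards nothing. -/
lemma ofReal_trigProj (M : ℕ) (g : ℝ → ℝ) (t : ℝ) :
    ((trigProj M g t : ℝ) : ℂ) = trigPoly (coeff g) M t := by
  have h : (starRingEnd ℂ) (trigPoly (coeff g) M t) = trigPoly (coeff g) M t := by
    unfold trigPoly
    rw [map_sum]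
    refine Finset.sum_nbij' (fun k => -k) (fun k => -k) ?_ ?_ ?_ ?_ ?_
    · intro k hk; rw [Finset.mem_Icc] at hk ⊢; omega
    · intro k hk; rw [Finset.mem_Icc] at hk ⊢; omega
    · simp
    · simp
    · intro k _
      rw [map_mul, conj_coeff, ← Complex.exp_conj]
      simp only [map_mul, Complex.conj_ofReal, Complex.conj_I, map_ofNat, map_intCast]
      congr 2
      push_cast
      ring
  exact Complex.conj_eq_iff_re.1 h

lemma trigPoly_eq_of_mem {g : ℝ → ℝ} {M : ℕ} (h : (fun t => (g t : ℂ)) ∈ trigSpace M) (t : ℝ) :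
    (g t : ℂ) = trigPoly (coeff g) M t := by
  obtain ⟨b, hb⟩ := exists_eq_trigPoly_of_mem h
  rw [hb]
  exact trigPoly_congr (fun k hk => by rw [coeff_of_eq_trigPoly hb, if_pos hk]) _

lemma continuous_trigProj (M : ℕ) (g : ℝ → ℝ) : Continuous (trigProj M g) := by
  have h : Continuous fun t : ℝ => ((trigProj M g t : ℝ) : ℂ) := by
    simp only [ofReal_trigProj]
    exact (differentiable_trigPoly _ _).continuous.comp Complex.continuous_ofReal
  exact (Complex.continuous_re.comp h).congr fun t => Complex.ofReal_re _

lemma periodic_trigProj (M : ℕ) (g : ℝ → ℝ) : Function.Periodic (trigProj M g) 1 := fun t => by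
  have := trigPoly_add_one (coeff g) M t
  have h : ((trigProj M g (t + 1) : ℝ) : ℂ) = trigProj M g t := by
    rw [ofReal_trigProj, ofReal_trigProj, ← this]
    push_cast; rfl
  exact_mod_cast h

lemma coeff_trigProj (M : ℕ) (g : ℝ → ℝ) (k : ℤ) :
    coeff (trigProj M g) k = if k ∈ Finset.Icc (-(M : ℤ)) M then coeff g k else 0 :=
  coeff_of_eq_trigPoly (ofReal_trigProj M g) k

lemma hasDerivAt_phaseIncrement (M : ℕ) (f φ : ℝ → ℝ) (t : ℝ) :
    HasDerivAt (phaseIncrement M f φ) (freqIncrement M f φ t) t := by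
  have hc : Continuous (freqIncrement M f φ) := continuous_trigProj _ _
  exact intervalIntegral.integral_hasDerivAt_right (hc.intervalIntegrable _ _)
    (hc.stronglyMeasurableAtFilter _ _) hc.continuousAt

lemma phaseIncrement_add_one (M : ℕ) (f φ : ℝ → ℝ) (t : ℝ) :
    phaseIncrement M f φ (t + 1) = phaseIncrement M f φ t +
      ∫ s in (0 : ℝ)..1, freqIncrement M f φ s := by
  have hc : Continuous (freqIncrement M f φ) := continuous_trigProj _ _
  have hp : Function.Periodic (freqIncrement M f φ) 1 := periodic_trigProj _ _
  unfold phaseIncrement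
  rw [← intervalIntegral.integral_add_adjacent_intervals (hc.intervalIntegrable 0 t)
    (hc.intervalIntegrable t (t + 1)), hp.intervalIntegral_add_eq t 0, zero_add]

lemma deriv_sub_of_isPhase {φ θ : ℝ → ℝ} (hφ : IsPhase φ) (hθ : IsPhase θ) :
    (deriv fun t => φ t - θ t) = fun t => deriv φ t - deriv θ t :=
  funext fun t => ((hφ.hasDerivAt t).sub (hθ.hasDerivAt t)).deriv

/-! ### Frequencies above M. -/

/-- The part of the `ℓ¹` norm that comes from the frequencies above `M`. -/
def l1Tail (M : ℕ) (g : ℝ → ℝ) : ENNReal :=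
  ∑' k : ℤ, if k ∈ Finset.Icc (-(M : ℤ)) M then 0 else ‖coeff g k‖ₑ

lemma l1Tail_le {g : ℝ → ℝ} {C p : ℝ} {M : ℕ} (hM : 1 ≤ M) (hC : 0 ≤ C) (hp : 3 ≤ p)
    (hg : ∀ k : ℤ, k ≠ 0 → ‖coeff g k‖ ≤ C * |(k : ℝ)| ^ (-p)) :
    l1Tail M g ≤ ENNReal.ofReal (C * (M : ℝ) ^ (-p + 1)) := by
  obtain ⟨h1, h2⟩ := summable_powTail_succ hM hp
  calc l1Tail M g ≤ ∑' k : ℤ, ENNReal.ofReal (C * powTail (M + 1) p k) := by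
        refine ENNReal.tsum_le_tsum fun k => ?_
        split_ifs with hk
        · exact zero_le
        · rw [← ofReal_norm]
          apply ENNReal.ofReal_le_ofReal
          unfold powTail
          rw [if_pos (lt_abs_of_notMem_Icc hk)]
          exact hg k fun h => hk (h ▸ zero_mem_Icc M)
    _ = ENNReal.ofReal (∑' k : ℤ, C * powTail (M + 1) p k) :=
        (ENNReal.ofReal_tsum_of_nonneg (fun k => mul_nonneg hC (powTail_nonneg _ _ _))
          (h1.mul_left C)).symm
    _ ≤ _ := by
        apply ENNReal.ofReal_le_ofReal
        rw [tsum_mul_left, neg_add_eq_sub]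
        gcongr

/-- Above M the first function has no coefficients, so the tail of the second is a part of their
distance. This yields both the contraction term and the uniform bound of the tail by the initial
error. -/
lemma l1Tail_le_l1Norm_sub {g h : ℝ → ℝ} (hg : Continuous g) (hh : Continuous h) {M : ℕ}
    (hmem : (fun t => (g t : ℂ)) ∈ trigSpace M) :
    l1Tail M h ≤ l1Norm fun t => g t - h t := by
  refine ENNReal.tsum_le_tsum fun k => ?_
  split_ifs with hk
  · exact zero_le
  · rw [coeff_sub hg hh, coeff_of_eq_trigPoly (trigPoly_eq_of_mem hmem), if_neg hk, zero_sub,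
      enorm_neg]

lemma l1Norm_le_add_l1Tail {g h : ℝ → ℝ} {M : ℕ} {b : ℝ}
    (h1 : ∀ k ∈ Finset.Icc (-(M : ℤ)) M, ‖coeff g k‖ ≤ b)
    (h2 : ∀ k ∉ Finset.Icc (-(M : ℤ)) M, coeff g k = -coeff h k) :
    l1Norm g ≤ ENNReal.ofReal ((2 * M + 1) * b) + l1Tail M h := by
  have hsum : ∑' k : ℤ, (if k ∈ Finset.Icc (-(M : ℤ)) M then ENNReal.ofReal b else 0) =
      ENNReal.ofReal ((2 * M + 1) * b) := by
    rw [tsum_eq_sum (s := Finset.Icc (-(M : ℤ)) M) (fun k hk => if_neg hk),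
      Finset.sum_congr rfl (fun k hk => if_pos hk), Finset.sum_const, nsmul_eq_mul, Int.card_Icc,
      show ((M : ℤ) + 1 - -(M : ℤ)).toNat = 2 * M + 1 by omega,
      ENNReal.ofReal_mul (by positivity)]
    congr 1
    rw [← ENNReal.ofReal_natCast]
    push_cast
    rfl
  unfold l1Norm l1Tail
  rw [← hsum, ← ENNReal.tsum_add]
  refine ENNReal.tsum_le_tsum fun k => ?_
  by_cases hk : k ∈ Finset.Icc (-(M : ℤ)) M
  · rw [if_pos hk, if_pos hk, add_zero, ← ofReal_norm]
    exact ENNReal.ofReal_le_ofReal (h1 k hk)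
  · rw [if_neg hk, if_neg hk, zero_add, h2 k hk, enorm_neg]

/-! ### One step of the iteration. -/

/-- The radius of the ball around the exact frequency in which the iteration stays. -/
def radius (M : ℕ) : ℝ := π * M / 2 + 1

lemma radius_pos (M : ℕ) : 0 < radius M := by
  have := Real.pi_pos
  unfold radius
  positivity

/-- The bound for the error of the computed envelope. -/
def envErr (B C p : ℝ) (M : ℕ) (L : ℝ) : ℝ :=
  constEnv B C (C + radius M) p (radius M) M * (L / (4 * p)) ^ (2 - p)

/-- The bound for the error that one step makes in the frequencies up to `M`, if the envelope is
at least `m`. -/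
def stepErr (B C p m : ℝ) (M : ℕ) (L : ℝ) : ℝ :=
  (2 * M + 1) * (2 * π * M * (envErr B C p M L / (m / 2)))

/-- The conditions under which the number `L` of periods counts as large. -/
structure IsLarge (B C p m : ℝ) (M : ℕ) (L : ℝ) : Prop where
  one_le : 1 ≤ L / (4 * p)
  le_trunc : (M : ℝ) ≤ L / (4 * p)
  trunc_small : 4 * C * (L / (4 * p)) ^ (1 - p) ≤ 1
  trig_le_log : constTrig (C + radius M) p M ≤ 2 * p * Real.log L
  linear_le : constTrig (C + radius M) p M + 32 * C + 40 * radius M ≤ L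
  envErr_le : envErr B C p M L ≤ m / 2
  stepErr_le : stepErr B C p m M L ≤ 1

/-- The invariant of the iteration. -/
structure IsNear (M : ℕ) (θ φ : ℝ → ℝ) : Prop where
  isPhase : IsPhase φ
  mem : (fun t => ((deriv φ t : ℝ) : ℂ)) ∈ trigSpace M
  l1Norm_le : l1Norm (deriv fun t => φ t - θ t) ≤ ENNReal.ofReal (radius M)

lemma envC_periodic {f φ : ℝ → ℝ} {n : ℤ} (hq : IsCircleDiffeo (normPhase φ)) (t : ℝ) :
    envC f φ n (t + 1) = envC f φ n t := by
  unfold envC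
  simp only [hq.map_add_one]
  push_cast
  simp only [cexp_add_one]

lemma exists_hasDerivAt_envC {f φ : ℝ → ℝ} {n : ℤ} (hq : IsCircleDiffeo (normPhase φ)) :
    ∃ e : ℝ → ℂ, Continuous e ∧ ∀ t, HasDerivAt (envC f φ n) (e t) t := by
  refine ⟨fun t => ∑ k ∈ lowFreq n, 2 * circCoeff (normPhase φ) (fun t => (f t : ℂ)) (k + n) *
    (cexp (2 * π * I * k * normPhase φ t) *
      (2 * π * I * k * ((deriv (normPhase φ) t : ℝ) : ℂ))), ?_, fun t => ?_⟩
  · have := hq.continuous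
    have := hq.continuous_deriv
    fun_prop
  · exact HasDerivAt.fun_sum fun k _ =>
      (((hq.hasDerivAt t).ofReal_comp.const_mul (2 * π * I * k : ℂ)).cexp).const_mul _

section Step

variable {θ φ f₀ f₁ : ℝ → ℝ} {B C p m : ℝ} {M : ℕ}

lemma abs_numPeriods_sub_le (hθ : IsPhase θ) (hφ : IsNear M θ φ) :
    |numPeriods θ - numPeriods φ| ≤ radius M := by
  have h := norm_coeff_le_of_l1Norm_le (radius_pos M).le hφ.l1Norm_le 0
  rw [deriv_sub_of_isPhase hφ.isPhase hθ, coeff_sub hφ.isPhase.continuous_deriv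
    hθ.continuous_deriv, hφ.isPhase.coeff_deriv_zero, hθ.coeff_deriv_zero,
    show (2 * π * numPeriods φ - 2 * π * numPeriods θ : ℂ) =
      ((2 * π * (numPeriods φ - numPeriods θ) : ℝ) : ℂ) by push_cast; ring, Complex.norm_real,
    Real.norm_eq_abs, abs_mul, abs_of_pos (by positivity : 0 < 2 * π), abs_sub_comm] at h
  have := Real.pi_gt_three
  nlinarith [abs_nonneg (numPeriods θ - numPeriods φ)]

lemma abs_deriv_sub_le_radius (hθ : IsPhase θ) (hφ : IsNear M θ φ) (t : ℝ) :
    |deriv φ t - deriv θ t| ≤ radius M := by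
  have h := hφ.l1Norm_le
  rw [deriv_sub_of_isPhase hφ.isPhase hθ] at h
  exact abs_le_of_l1Norm_le (hφ.isPhase.continuous_deriv.sub hθ.continuous_deriv)
    (hφ.isPhase.periodic_deriv.sub hθ.periodic_deriv) (radius_pos M).le h t

/-- The error of the low frequencies of the computed correction. -/
lemma norm_coeff_deriv_arctan_env_sub_le (hθ : IsPhase θ) (hφ : IsNear M θ φ)
    (hf₀ : Continuous f₀) (hf₀1 : Function.Periodic f₀ 1)
    (hf₁ : Continuous f₁) (hf₁1 : Function.Periodic f₁ 1)
    (hm : 0 < m) (hfm : ∀ t, m ≤ f₁ t) (hfB : ∀ t, 2 * f₁ t ≤ B) (hC : 0 ≤ C) (hp : 4 ≤ p)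
    (ha : ∀ k : ℤ, k ≠ 0 → ‖coeff (deriv θ) k‖ ≤ C * |(k : ℝ)| ^ (-p))
    (hc₀ : ∀ k : ℤ, k ≠ 0 → ‖phaseFourier θ f₀ k‖ ≤ C * |(k : ℝ)| ^ (-p))
    (hc₁ : ∀ k : ℤ, k ≠ 0 → ‖phaseFourier θ f₁ k‖ ≤ C * |(k : ℝ)| ^ (-p))
    (hL : IsLarge B C p m M (numPeriods θ)) (k : ℤ) :
    ‖coeff (deriv fun t => Real.arctan (envB (fun s => f₀ s + f₁ s * Real.cos (θ s)) φ t /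
      envA (fun s => f₀ s + f₁ s * Real.cos (θ s)) φ t)) k -
      coeff (fun t => deriv θ t - deriv φ t) k‖ ≤
      2 * π * |(k : ℝ)| * (envErr B C p M (numPeriods θ) / (m / 2)) := by
  obtain ⟨n, hn, hθn⟩ := hθ.exists_numPeriods_eq
  obtain ⟨n', hn', hφn⟩ := hφ.isPhase.exists_numPeriods_eq
  have hLL := abs_numPeriods_sub_le hθ hφ
  have hderθ := abs_deriv_sub_le hθ hC (by linarith : 2 ≤ p) ha
  have hderφ := abs_deriv_sub_le_radius hθ hφ
  have hR := radius_pos M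
  have hT0 : 0 ≤ constTrig (C + radius M) p M := by unfold constTrig; positivity
  have hlin := hL.linear_le
  have hpi3 := Real.pi_gt_three
  have hpi4 := Real.pi_lt_four
  set L := numPeriods θ with hLdef
  have hLL1 := abs_le.1 hLL
  rw [hn'] at hLL hLL1
  have hL0 : 0 < L := by linarith
  have hn'0 : (0 : ℝ) < n' := by linarith
  have hqθ : IsCircleDiffeo (normPhase θ) := hθ.isCircleDiffeo_normPhase hL0 fun t =>
    (hderθ t).trans (by nlinarith)
  have hqφ : IsCircleDiffeo (normPhase φ) :=
    hφ.isPhase.isCircleDiffeo_normPhase (by rw [hn']; exact hn'0) fun t => by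
      rw [hn']
      have h1 := abs_le.1 (hderθ t)
      have h2 := abs_le.1 (hderφ t)
      have h3 : 2 * π * (L - n') ≤ 8 * radius M := by nlinarith
      have h4 : -(8 * radius M) ≤ 2 * π * (L - n') := by nlinarith
      have h5 : 3 * (n' : ℝ) ≤ π * n' := by nlinarith
      rw [abs_le]
      constructor <;> linarith
  have hφ' := trigPoly_eq_of_mem hφ.mem
  have hd0 : coeff (deriv φ) 0 = 2 * π * n' := by
    rw [hφ.isPhase.coeff_deriv_zero, hn']; push_cast; rfl
  have hd : ∀ k : ℤ, k ≠ 0 → ‖coeff (deriv φ) k‖ ≤ C + radius M := by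
    intro k hk
    have h := norm_coeff_le_of_l1Norm_le hR.le hφ.l1Norm_le k
    rw [deriv_sub_of_isPhase hφ.isPhase hθ, coeff_sub hφ.isPhase.continuous_deriv
      hθ.continuous_deriv] at h
    have h1 := norm_le_norm_sub_add (coeff (deriv φ) k) (coeff (deriv θ) k)
    have h2 : |(k : ℝ)| ^ (-p) ≤ 1 :=
      Real.rpow_le_one_of_one_le_of_nonpos (one_le_abs_intCast hk) (by linarith)
    have h3 := ha k hk
    nlinarith
  have hB0 : 0 ≤ B := by linarith [hfm 0, hfB 0]
  have hc₁0 : ‖phaseFourier θ f₁ ((0 : ℤ) : ℝ)‖ ≤ B := by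
    rw [phaseFourier_intCast]
    -- B is twice a bound of f₁ because a change of variable with derivative up to 2 doubles the
    -- bound of the coefficients.
    have := hqθ.norm_circCoeff_le (g := fun t => (f₁ t : ℂ)) (B := B / 2) (fun t _ => by
      rw [Complex.norm_real, Real.norm_eq_abs, abs_of_pos (by linarith [hfm t])]
      linarith [hfB t]) 0
    linarith
  set f : ℝ → ℝ := fun s => f₀ s + f₁ s * Real.cos (θ s) with hf
  set E := envErr B C p M L with hE
  have henv : ∀ t ∈ Icc (0 : ℝ) 1, ‖envC f φ n' t -
      f₁ t * cexp (I * (1 : ℤ) * ((θ t - (φ t - φ 0) : ℝ) : ℂ))‖ ≤ E := fun t ht =>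
    norm_envC_sub_le hθ hφ.isPhase hqθ hqφ hf₀ hf₀1 hf₁ hf₁1 hB0 hC (by positivity) hp hL.one_le
      (by field_simp; exact hLdef.symm) hL.trunc_small hL.le_trunc hn' hLL (by linarith) (by linarith)
      hL.trig_le_log (by nlinarith) ha hφ' hd0 hd hc₀ hc₁ hc₁0 ht
  -- Rotating back by Δ turns the target into the real number f₁, so the envelope error bounds
  -- separately the distance of the real part from f₁ and the imaginary part.
  have hrot : ∀ t, (envC f φ n' t - f₁ t * cexp (I * (1 : ℤ) * ((θ t - (φ t - φ 0) : ℝ) : ℂ))) *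
      cexp (-(((θ t - (φ t - φ 0) : ℝ) : ℂ) * I)) = ((((envC f φ n' t).re *
        Real.cos (θ t - (φ t - φ 0)) + (envC f φ n' t).im *
        Real.sin (θ t - (φ t - φ 0))) - f₁ t : ℝ) : ℂ) +
      (((envC f φ n' t).im * Real.cos (θ t - (φ t - φ 0)) - (envC f φ n' t).re *
        Real.sin (θ t - (φ t - φ 0)) : ℝ) : ℂ) * I := by
    intro t
    set x := θ t - (φ t - φ 0)
    rw [sub_mul, mul_assoc, ← Complex.exp_add,
      show I * (1 : ℤ) * (x : ℂ) + -(x * I) = 0 by push_cast; ring, Complex.exp_zero, mul_one,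
      show -((x : ℂ) * I) = ((-x : ℝ) : ℂ) * I by push_cast; ring, Complex.exp_mul_I,
      ← Complex.ofReal_cos, ← Complex.ofReal_sin, Real.cos_neg, Real.sin_neg]
    apply Complex.ext <;> simp [mul_re, mul_im]
    ring
  have hsmall : ∀ t ∈ Icc (0 : ℝ) 1, |((envC f φ n' t).re * Real.cos (θ t - (φ t - φ 0)) +
        (envC f φ n' t).im * Real.sin (θ t - (φ t - φ 0))) - f₁ t| ≤ E ∧
      |(envC f φ n' t).im * Real.cos (θ t - (φ t - φ 0)) - (envC f φ n' t).re *
        Real.sin (θ t - (φ t - φ 0))| ≤ E := by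
    intro t ht
    have h1 := henv t ht
    have h2 : ‖cexp (-(((θ t - (φ t - φ 0) : ℝ) : ℂ) * I))‖ = 1 := by
      rw [← neg_mul, ← Complex.ofReal_neg, Complex.norm_exp_ofReal_mul_I]
    have h3 := congrArg norm (hrot t)
    rw [norm_mul, h2, mul_one] at h3
    rw [h3] at h1
    have h4 := (Complex.abs_re_le_norm _).trans h1
    have h5 := (Complex.abs_im_le_norm _).trans h1
    simp only [add_re, add_im, mul_re, mul_im, ofReal_re, ofReal_im, I_re, I_im, mul_zero,
      mul_one, sub_zero, add_zero, zero_add] at h4 h5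
    exact ⟨h4, h5⟩
  have hn'pos : 0 < n' := by exact_mod_cast hn'0
  have hA : envA f φ = fun t => (envC f φ n' t).re := funext fun t => (env_eq hn'pos hn' t).1
  have hBe : envB f φ = fun t => (envC f φ n' t).im := funext fun t => (env_eq hn'pos hn' t).2
  obtain ⟨e, hec, hed⟩ := exists_hasDerivAt_envC (f := f) (n := n') hqφ
  have hper1 : envC f φ n' 1 = envC f φ n' 0 := by simpa using envC_periodic (f := f) hqφ 0
  have hΔ1 : θ 1 - (φ 1 - φ 0) = (θ 0 - (φ 0 - φ 0)) + ((n - n' : ℤ) : ℝ) * (2 * π) := by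
    have h1 := hθn 0
    have h2 := hφn 0
    rw [zero_add] at h1 h2
    rw [h1, h2]
    push_cast
    ring
  have hfin := norm_coeff_deriv_arctan_sub_le (A := fun t => (envC f φ n' t).re)
    (B := fun t => (envC f φ n' t).im) (D := fun t => θ t - (φ t - φ 0))
    (A' := fun t => (e t).re) (B' := fun t => (e t).im) (D' := fun t => deriv θ t - deriv φ t)
    (m := m / 2) (E := E)
    (fun t => Complex.reCLM.hasFDerivAt.comp_hasDerivAt t (hed t))
    (fun t => Complex.imCLM.hasFDerivAt.comp_hasDerivAt t (hed t))
    (fun t => (hθ.hasDerivAt t).sub ((hφ.isPhase.hasDerivAt t).sub_const _))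
    (Complex.continuous_re.comp hec) (Complex.continuous_im.comp hec)
    (hθ.continuous_deriv.sub hφ.isPhase.continuous_deriv)
    (by simp only [hper1]) (by simp only [hper1])
    (by simp only [hΔ1]; exact Real.cos_add_int_mul_two_pi _ _)
    (by simp only [hΔ1]; exact Real.sin_add_int_mul_two_pi _ _) (by positivity)
    (fun t ht => by
      have h1 := (abs_le.1 (hsmall t ht).1).1
      have h2 := hL.envErr_le
      have h3 := hfm t
      linarith)
    (fun t ht => (hsmall t ht).2) k
  rw [hA, hBe]
  exact hfin

/-- One step of the iteration. -/
lemma phaseStep_isNear (hM : 1 ≤ M) (hθ : IsPhase θ) (hφ : IsNear M θ φ)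
    (hf₀ : Continuous f₀) (hf₀1 : Function.Periodic f₀ 1)
    (hf₁ : Continuous f₁) (hf₁1 : Function.Periodic f₁ 1)
    (hm : 0 < m) (hfm : ∀ t, m ≤ f₁ t) (hfB : ∀ t, 2 * f₁ t ≤ B) (hC : 0 ≤ C) (hp : 4 ≤ p)
    (ha : ∀ k : ℤ, k ≠ 0 → ‖coeff (deriv θ) k‖ ≤ C * |(k : ℝ)| ^ (-p))
    (hc₀ : ∀ k : ℤ, k ≠ 0 → ‖phaseFourier θ f₀ k‖ ≤ C * |(k : ℝ)| ^ (-p))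
    (hc₁ : ∀ k : ℤ, k ≠ 0 → ‖phaseFourier θ f₁ k‖ ≤ C * |(k : ℝ)| ^ (-p))
    (hL : IsLarge B C p m M (numPeriods θ))
    (htail : l1Tail M (deriv θ) ≤ ENNReal.ofReal (π * M / 2)) :
    IsNear M θ (phaseStep M (fun s => f₀ s + f₁ s * Real.cos (θ s)) φ) ∧
      l1Norm (deriv fun t => phaseStep M (fun s => f₀ s + f₁ s * Real.cos (θ s)) φ t - θ t) ≤
        ENNReal.ofReal (stepErr B C p m M (numPeriods θ)) + l1Tail M (deriv θ) := by
  have hcoef := norm_coeff_deriv_arctan_env_sub_le hθ hφ hf₀ hf₀1 hf₁ hf₁1 hm hfm hfB hC hp ha hc₀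
    hc₁ hL
  set f : ℝ → ℝ := fun s => f₀ s + f₁ s * Real.cos (θ s) with hf
  set h : ℝ → ℝ := deriv fun t => Real.arctan (envB f φ t / envA f φ t) with hh
  have hφP := hφ.isPhase
  have hfreq : freqIncrement M f φ = trigProj M h := rfl
  set ψ : ℝ → ℝ := fun t => φ t + 1 * phaseIncrement M f φ t with hψ
  have hψd : ∀ t, HasDerivAt ψ (deriv φ t + trigProj M h t) t := fun t => by
    have := (hφP.hasDerivAt t).add ((hasDerivAt_phaseIncrement M f φ t).const_mul 1)
    rwa [one_mul, hfreq] at this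
  have hψ' : deriv ψ = fun t => deriv φ t + trigProj M h t := funext fun t => (hψd t).deriv
  have hcP : Continuous (trigProj M h) := continuous_trigProj M h
  have hψc : Continuous (deriv ψ) := by
    rw [hψ']; exact hφP.continuous_deriv.add hcP
  have hψP : IsPhase ψ := by
    refine ⟨contDiff_one_iff_deriv.2 ⟨fun t => (hψd t).differentiableAt, hψc⟩, ?_⟩
    obtain ⟨n, hn, -⟩ := hθ.exists_numPeriods_eq
    obtain ⟨n', hn', hφn⟩ := hφP.exists_numPeriods_eq
    refine ⟨n, fun t => ?_⟩
    -- The error bound carries the factor |k|, so the mean of the correction is exact. The new phase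
    -- has exactly as many periods as θ and is again a phase function.
    have h0 : coeff h 0 = coeff (fun t => deriv θ t - deriv φ t) 0 := by
      have := hcoef 0
      simp only [Int.cast_zero, abs_zero, mul_zero, zero_mul] at this
      exact sub_eq_zero.1 (norm_le_zero_iff.1 this)
    have hint : ∫ s in (0 : ℝ)..1, freqIncrement M f φ s = 2 * π * (n - n') := by
      have h1 := coeff_zero_eq_integral (trigProj M h)
      rw [coeff_trigProj, if_pos (zero_mem_Icc M), h0, coeff_sub hθ.continuous_deriv
        hφP.continuous_deriv, hθ.coeff_deriv_zero, hφP.coeff_deriv_zero, hn, hn'] at h1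
      rw [hfreq]
      have h2 : ((∫ s in (0 : ℝ)..1, trigProj M h s : ℝ) : ℂ) = ((2 * π * (n - n') : ℝ) : ℂ) := by
        rw [← h1]; push_cast; ring
      exact_mod_cast h2
    simp only [hψ]
    rw [phaseIncrement_add_one, hint, hφn]
    ring
  have hψmem : (fun t => ((deriv ψ t : ℝ) : ℂ)) ∈ trigSpace M := by
    have e : (fun t => ((deriv ψ t : ℝ) : ℂ)) = (fun t => ((deriv φ t : ℝ) : ℂ)) +
        fun t : ℝ => trigPoly (coeff h) M t := by
      ext t
      rw [hψ']
      simp [ofReal_trigProj]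
    rw [e]
    exact Submodule.add_mem _ hφ.mem (trigPoly_mem_trigSpace _ _)
  have hEm : 0 ≤ envErr B C p M (numPeriods θ) / (m / 2) := by
    have := (norm_nonneg _).trans (hcoef 1)
    have h2 : 0 < 2 * π * |((1 : ℤ) : ℝ)| := by
      have := Real.pi_pos
      simp only [Int.cast_one, abs_one]
      positivity
    exact nonneg_of_mul_nonneg_right this h2
  have hbound : l1Norm (deriv fun t => ψ t - θ t) ≤
      ENNReal.ofReal (stepErr B C p m M (numPeriods θ)) + l1Tail M (deriv θ) := by
    have hcψ : ∀ k, coeff (deriv fun t => ψ t - θ t) k =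
        (coeff (deriv φ) k + if k ∈ Finset.Icc (-(M : ℤ)) M then coeff h k else 0) -
          coeff (deriv θ) k := fun k => by
      rw [deriv_sub_of_isPhase hψP hθ, coeff_sub hψc hθ.continuous_deriv, hψ',
        coeff_add hφP.continuous_deriv hcP, coeff_trigProj]
    refine l1Norm_le_add_l1Tail (fun k hk => ?_) (fun k hk => ?_)
    · rw [hcψ, if_pos hk]
      have h1 := hcoef k
      rw [coeff_sub hθ.continuous_deriv hφP.continuous_deriv] at h1
      have h2 := abs_le_of_mem_Icc hk
      have := Real.pi_pos
      calc _ = ‖coeff h k - (coeff (deriv θ) k - coeff (deriv φ) k)‖ := by congr 1; ring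
        _ ≤ _ := h1
        _ ≤ _ := by gcongr
    · rw [hcψ, if_neg hk, coeff_of_eq_trigPoly (trigPoly_eq_of_mem hφ.mem), if_neg hk]
      ring
  -- The low-frequency error is at most 1, the extra summand in `radius`, and the tail of θ' is at
  -- most πM/2 at every step, so errors do not accumulate.
  have hψnear : l1Norm (deriv fun t => ψ t - θ t) ≤ ENNReal.ofReal (radius M) := by
    refine hbound.trans ((add_le_add (ENNReal.ofReal_le_ofReal hL.stepErr_le) htail).trans ?_)
    rw [← ENNReal.ofReal_add zero_le_one (by have := Real.pi_pos; positivity)]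
    apply ENNReal.ofReal_le_ofReal
    unfold radius
    linarith
  have hnear : IsNear M θ ψ := ⟨hψP, hψmem, hψnear⟩
  -- θ' is 2πL up to 4C, and for large L this outweighs the distance of ψ' from θ'. The full step is
  -- therefore admissible.
  have hpos : ∀ t, 0 ≤ deriv ψ t := fun t => by
    have h1 := (abs_le.1 (abs_deriv_sub_le_radius hθ hnear t)).1
    have h2 := (abs_le.1 (abs_deriv_sub_le hθ hC (by linarith : 2 ≤ p) ha t)).1
    have h3 := hL.linear_le
    have hT0 : 0 ≤ constTrig (C + radius M) p M := by
      have := radius_pos M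
      unfold constTrig; positivity
    have h4 := Real.pi_gt_three
    have := radius_pos M
    have h5 : 0 < numPeriods θ := by linarith
    nlinarith
  have hβ : stepLength M f φ = 1 := by
    refine IsGreatest.csSup_eq ⟨⟨⟨zero_le_one, le_rfl⟩, hpos⟩, fun α hα => hα.1.2⟩
  have hstep : phaseStep M f φ = ψ := by
    ext t
    simp only [phaseStep, hβ, hψ]
  rw [hstep]
  exact ⟨hnear, hbound⟩

end Step

/-! ### The conditions on L, and the conclusion. -/

lemma eventually_rpow_le {a c b ε : ℝ} (hc : 0 < c) (ha : a < 0) (hε : 0 < ε) :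
    ∀ᶠ L : ℝ in Filter.atTop, b * (L / c) ^ a ≤ ε := by
  have h1 : Filter.Tendsto (fun L : ℝ => b * (L / c) ^ a) Filter.atTop (nhds (b * 0)) := by
    refine Filter.Tendsto.const_mul b ?_
    have := tendsto_rpow_neg_atTop (neg_pos.2 ha)
    rw [neg_neg] at this
    exact this.comp (Filter.tendsto_id.atTop_div_const hc)
  rw [mul_zero] at h1
  exact (h1.eventually (gt_mem_nhds hε)).mono fun L h => h.le

lemma eventually_isLarge (B C : ℝ) {p m : ℝ} (M : ℕ) (hp : 4 ≤ p) (hm : 0 < m) :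
    ∀ᶠ L in Filter.atTop, IsLarge B C p m M L := by
  have hp0 : 0 < 4 * p := by linarith
  have hdiv : Filter.Tendsto (fun L : ℝ => L / (4 * p)) Filter.atTop Filter.atTop :=
    Filter.tendsto_id.atTop_div_const hp0
  have hlog : Filter.Tendsto (fun L : ℝ => 2 * p * Real.log L) Filter.atTop Filter.atTop :=
    Real.tendsto_log_atTop.const_mul_atTop (by linarith)
  have hstep : ∀ᶠ L : ℝ in Filter.atTop, stepErr B C p m M L ≤ 1 := by
    have := eventually_rpow_le (b := (2 * M + 1) * (2 * π * M *
      (constEnv B C (C + radius M) p (radius M) M / (m / 2)))) hp0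
      (by linarith : 2 - p < 0) one_pos
    filter_upwards [this] with L hL
    unfold stepErr envErr
    refine le_trans (le_of_eq ?_) hL
    ring
  filter_upwards [hdiv.eventually_ge_atTop 1, hdiv.eventually_ge_atTop (M : ℝ),
    eventually_rpow_le hp0 (by linarith : 1 - p < 0) one_pos,
    hlog.eventually_ge_atTop (constTrig (C + radius M) p M),
    Filter.eventually_ge_atTop (constTrig (C + radius M) p M + 32 * C + 40 * radius M),
    eventually_rpow_le hp0 (by linarith : 2 - p < 0) (half_pos hm), hstep]
    with L h1 h2 h3 h4 h5 h6 h7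
  exact ⟨h1, h2, h3, h4, h5, h6, h7⟩

lemma exists_pos_bounds {f : ℝ → ℝ} (hf : Continuous f) (hper : Function.Periodic f 1)
    (hpos : ∀ t, 0 < f t) : ∃ m > 0, ∃ b, ∀ t, m ≤ f t ∧ f t ≤ b := by
  obtain ⟨x, -, hx⟩ := isCompact_Icc.exists_isMinOn (nonempty_Icc.2 (zero_le_one' ℝ))
    hf.continuousOn
  obtain ⟨y, -, hy⟩ := isCompact_Icc.exists_isMaxOn (nonempty_Icc.2 (zero_le_one' ℝ))
    hf.continuousOn
  refine ⟨f x, hpos x, f y, fun t => ?_⟩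
  obtain ⟨s, hs, hst⟩ := hper.exists_mem_Ico₀ one_pos t
  rw [hst]
  exact ⟨hx (Ico_subset_Icc_self hs), hy (Ico_subset_Icc_self hs)⟩

end PhaseRecovery

end

theorem mainTheorem3 (C₀ p : ℝ) (hC₀ : 0 < C₀) (hp : 4 ≤ p) (M₀ : ℕ) (hM₀ : 1 ≤ M₀)
    (f₁ : ℝ → ℝ) (hf₁ : Continuous f₁) (hf₁_per : Function.Periodic f₁ 1)
    (hf₁_pos : ∀ t, 0 < f₁ t) :
    ∃ Γ₀ : ℝ, 0 < Γ₀ ∧ ∃ η₀ : ℝ, 0 < η₀ ∧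
      ∀ f₀ θ θ₀ : ℝ → ℝ,
        Continuous f₀ → Function.Periodic f₀ 1 →
        PhaseRecovery.IsPhase θ → (∀ t, 0 < deriv θ t) →
        (∀ k : ℤ, k ≠ 0 → ‖PhaseRecovery.coeff (deriv θ) k‖ ≤ C₀ * |(k : ℝ)| ^ (-p)) →
        (∀ k : ℤ, k ≠ 0 → ‖PhaseRecovery.phaseFourier θ f₀ k‖ ≤ C₀ * |(k : ℝ)| ^ (-p)) →
        (∀ k : ℤ, k ≠ 0 → ‖PhaseRecovery.phaseFourier θ f₁ k‖ ≤ C₀ * |(k : ℝ)| ^ (-p)) →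
        η₀ ≤ PhaseRecovery.numPeriods θ →
        PhaseRecovery.IsPhase θ₀ →
        (fun t => ((deriv θ₀ t : ℝ) : ℂ)) ∈ PhaseRecovery.trigSpace M₀ →
        PhaseRecovery.l1Norm (deriv fun t => θ₀ t - θ t) ≤ ENNReal.ofReal (π * M₀ / 2) →
        ∀ m : ℕ,
          PhaseRecovery.l1Norm (deriv fun t =>
              PhaseRecovery.phaseIter M₀ (fun s => f₀ s + f₁ s * Real.cos (θ s)) θ₀ (m + 1) t
                - θ t)
            ≤ ENNReal.ofReal
                (Γ₀ * (PhaseRecovery.numPeriods θ / 4) ^ (-p + 2)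
                  + 1 / 2 * C₀ * (M₀ : ℝ) ^ (-p + 1))
              + 1 / 2 * PhaseRecovery.l1Norm (deriv fun t =>
                  PhaseRecovery.phaseIter M₀ (fun s => f₀ s + f₁ s * Real.cos (θ s)) θ₀ m t
                    - θ t) := by
  open PhaseRecovery in
  obtain ⟨μ, hμ, b, hb⟩ := exists_pos_bounds hf₁ hf₁_per hf₁_pos
  obtain ⟨η, hη⟩ := Filter.eventually_atTop.1 (eventually_isLarge (2 * b) C₀ M₀ hp hμ)
  -- The factor p^{p-2} converts the power of L/(4p) into that of L/4. The constant Γ₀ is taken as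
  -- |A| + 1, which is visibly positive.
  set A : ℝ := (2 * M₀ + 1) * (2 * π * M₀ *
    (constEnv (2 * b) C₀ (C₀ + radius M₀) p (radius M₀) M₀ / (μ / 2))) * p ^ (p - 2) with hA
  refine ⟨|A| + 1, by positivity, max η 1, by positivity, ?_⟩
  intro f₀ θ θ₀ hf₀ hf₀1 hθ _ ha hc₀ hc₁ hLη hθ₀ hmem hinit m
  have hL := hη _ ((le_max_left _ _).trans hLη)
  have hL0 : 0 < numPeriods θ := one_pos.trans_le ((le_max_right _ _).trans hLη)
  have htail : l1Tail M₀ (deriv θ) ≤ ENNReal.ofReal (π * M₀ / 2) := by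
    rw [deriv_sub_of_isPhase hθ₀ hθ] at hinit
    exact (l1Tail_le_l1Norm_sub hθ₀.continuous_deriv hθ.continuous_deriv hmem).trans hinit
  have hstep := fun (φ : ℝ → ℝ) (hφ : IsNear M₀ θ φ) => phaseStep_isNear hM₀ hθ hφ hf₀ hf₀1 hf₁
    hf₁_per hμ (fun t => (hb t).1) (fun t => by linarith [(hb t).2]) hC₀.le hp ha hc₀ hc₁ hL htail
  have hnear : ∀ m, IsNear M₀ θ
      (phaseIter M₀ (fun s => f₀ s + f₁ s * Real.cos (θ s)) θ₀ m) := by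
    intro m
    induction m with
    | zero =>
      refine ⟨hθ₀, hmem, hinit.trans (ENNReal.ofReal_le_ofReal ?_)⟩
      unfold radius
      linarith
    | succ m ih => exact (hstep _ ih).1
  set φ := phaseIter M₀ (fun s => f₀ s + f₁ s * Real.cos (θ s)) θ₀ m with hφ
  have hφn : IsNear M₀ θ φ := hnear m
  refine ((hstep φ hφn).2).trans ?_
  have herr : stepErr (2 * b) C₀ p μ M₀ (numPeriods θ) ≤
      (|A| + 1) * (numPeriods θ / 4) ^ (-p + 2) := by
    have hpow : (numPeriods θ / (4 * p)) ^ (2 - p) =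
        p ^ (p - 2) * (numPeriods θ / 4) ^ (-p + 2) := by
      rw [← div_div, Real.div_rpow (by positivity) (by positivity), div_eq_mul_inv,
        ← Real.rpow_neg (by positivity), neg_sub, mul_comm, neg_add_eq_sub]
    have he : stepErr (2 * b) C₀ p μ M₀ (numPeriods θ) =
        A * (numPeriods θ / 4) ^ (-p + 2) := by
      unfold stepErr envErr
      rw [hpow, hA]
      ring
    rw [he]
    have := le_abs_self A
    gcongr
    linarith
  have ht1 : l1Tail M₀ (deriv θ) ≤ ENNReal.ofReal (C₀ * (M₀ : ℝ) ^ (-p + 1)) :=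
    l1Tail_le hM₀ hC₀.le (by linarith) ha
  have ht2 : l1Tail M₀ (deriv θ) ≤ l1Norm (deriv fun t => φ t - θ t) := by
    rw [deriv_sub_of_isPhase hφn.isPhase hθ]
    exact l1Tail_le_l1Norm_sub hφn.isPhase.continuous_deriv hθ.continuous_deriv hφn.mem
  rw [ENNReal.ofReal_add (by positivity) (by positivity), add_assoc]
  refine add_le_add (ENNReal.ofReal_le_ofReal herr) ?_
  -- One half of the tail is bounded by the decay of θ', the other half by the error of the current
  -- iterate.
  calc l1Tail M₀ (deriv θ) = 1 / 2 * l1Tail M₀ (deriv θ) + 1 / 2 * l1Tail M₀ (deriv θ) := by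
        rw [← add_mul, ENNReal.add_halves, one_mul]
    _ ≤ ENNReal.ofReal (1 / 2 * C₀ * (M₀ : ℝ) ^ (-p + 1)) +
        1 / 2 * l1Norm (deriv fun t => φ t - θ t) := by
        refine add_le_add ?_ (by gcongr)
        have : ENNReal.ofReal (1 / 2 * C₀ * (M₀ : ℝ) ^ (-p + 1)) =
            1 / 2 * ENNReal.ofReal (C₀ * (M₀ : ℝ) ^ (-p + 1)) := by
          rw [mul_assoc, ENNReal.ofReal_mul (by norm_num)]
          congr 1
          rw [ENNReal.ofReal_div_of_pos two_pos]
          simp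
        rw [this]
        gcongr
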